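/- Let $\mathbf{k}$ be a field of characteristic $\neq 2$ containing a primitive cube root of unity $j$. Let $\mathrm{Aut}(\mathbf{k}^2)$ be the group of polynomial automorphisms of the affine plane over $\mathbf{k}$, with $(f_1,f_2)$ denoting $(x,y)\mapsto(f_1(x,y),f_2(x,y))$ and product the composition. Let $A$ be its subgroup of affine automorphisms $(ax+by+e,\ cx+dy+e')$, $ad-bc\neq0$, and $B$ its subgroup of elementary automorphisms $(ax+P(y),\ by+c)$, $ab\ne 0$, $P\in\mathbf{k}[y]$. Let $G=\mathrm{Aut}(\mathbf{k}^2)$ act by left translation on its Bass–Serre tree $T$, whose vertices are the left cosets $fA$ and $fB$ and whose edges are the left cosets $f(A\cap B)$, joining $fA$ to $fB$; here $T$ denotes the geometric realization, with the path metric $d$ for which every edge has length $1$. For $h\in G$ let $\ell(h)=\inf_{x\in T}d(x,hx)$ and $\mathrm{Axe}(h)=\mathrm{Min}(h)=\{x\in T: d(x,hx)=\ell(h)\}$; $h$ is loxodromic if $\ell(h)>0$ (in the tree $T$ the infimum is then attained, and $\mathrm{Axe}(h)$ is a geodesic line). An element $h\in G$ is WPD if for some (equivalently every) $x\in T$ and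 for every $\varepsilon\ge0$ there is $N\in\mathbf{N}$ such that $\{u\in G : d(x,ux)\le\varepsilon,\ d(h^Nx,uh^Nx)\le\varepsilon\}$ is finite. A loxodromic $h\in G$ is tight if there is $B_0>0$ such that, for every $\varphi\in G$, $\operatorname{diam}(\mathrm{Axe}(h)\cap\varphi(\mathrm{Axe}(h)))>B_0$ implies $\varphi h\varphi^{-1}\in\{h,h^{-1}\}$. Let $g=(x^2-y,\ x)$ and $f=(jx,\ j^2y)$ in $G$. Then $g$ is loxodromic and WPD, but $g$ is not tight. Moreover $gf=f^2g$; $f$ commutes with $g^2$ but not with $g$; and $\mathrm{Axe}(fgf^{-1})=\mathrm{Axe}(g)$, although $fgf^{-1}\neq g$ and $fgf^{-1}\neq g^{-1}$. -/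

import Mathlib

open MvPolynomial

/-! ### Isometric actions on (extended) metric spaces -/

section IsometricActions

variable {G X : Type*} [Group G] [PseudoEMetricSpace X] [MulAction G X]

/-- The set `{h ∈ G | d(x, hx) ≤ ε and d(y, hy) ≤ ε}`. -/
def coarseFix (G : Type*) {X : Type*} [Group G] [PseudoEMetricSpace X] [MulAction G X]
    (ε : NNReal) (x y : X) : Set G :=
  {h : G | edist x (h • x) ≤ ε ∧ edist y (h • y) ≤ ε}

/-- The WPD condition: for some `x` (equivalently, for every `x`, if all distances are finite) and for
every `ε ≥ 0` there is `N` such that only finitely many `h` satisfy `d(x, hx) ≤ ε` and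
`d(g^N x, h g^N x) ≤ ε`. -/
def IsWPD (X : Type*) {G : Type*} [Group G] [PseudoEMetricSpace X] [MulAction G X]
    (g : G) : Prop :=
  ∃ x : X, ∀ ε : NNReal, ∃ N : ℕ, (coarseFix G ε x (g ^ N • x)).Finite

/-- The translation length `ℓ(g) = inf_x d(x, gx)`. -/
noncomputable def translationLength (X : Type*) {G : Type*} [Group G] [PseudoEMetricSpace X]
    [MulAction G X] (g : G) : ENNReal :=
  ⨅ x : X, edist x (g • x)

/-- `Min(g)`, the set of points realizing the translation length. It is the axis of `g` when `g` is
a loxodromic isometry of a tree. -/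
def axis (X : Type*) {G : Type*} [Group G] [PseudoEMetricSpace X] [MulAction G X] (g : G) :
    Set X :=
  {x : X | edist x (g • x) = translationLength X g}

/-- An isometry is loxodromic if its translation length is positive and is attained (in a tree it is
always attained, so that loxodromic means: without fixed points). -/
def IsLoxodromic (X : Type*) {G : Type*} [Group G] [PseudoEMetricSpace X] [MulAction G X]
    (g : G) : Prop :=
  0 < translationLength X g ∧ (axis X g).Nonempty

/-- Tight elements. The diameter is an extended real number, `∞` for unbounded sets. -/
def IsTight (X : Type*) {G : Type*} [Group G] [PseudoEMetricSpace X] [MulAction G X]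
    (g : G) : Prop :=
  IsLoxodromic X g ∧
    ∃ B : ℝ, 0 < B ∧ ∀ φ : G,
      ENNReal.ofReal B < Metric.ediam (axis X g ∩ (fun x : X => φ • x) '' axis X g) →
        φ * g * φ⁻¹ = g ∨ φ * g * φ⁻¹ = g⁻¹

end IsometricActions

/-! ### The geometric realization of a graph, with edges of length one -/

/-- The geometric realization of a graph: points are given by their barycentric coordinates, and the
support of a point is contained in a vertex or in an edge. -/
@[ext] structure GraphRealization {V : Type*} (Γ : SimpleGraph V) where
  /-- barycentric coordinates -/
  coord : V →₀ ℝ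
  nonneg : ∀ v, 0 ≤ coord v
  sum_eq_one : (coord.sum fun _ a => a) = 1
  cell : ∃ u v, (u = v ∨ Γ.Adj u v) ∧ ∀ w, coord w ≠ 0 → w = u ∨ w = v

namespace GraphRealization

variable {V : Type*} {Γ : SimpleGraph V}

/-- `p` lies on the closed segment between the vertices `u` and `v`. -/
def LiesOn (p : GraphRealization Γ) (u v : V) : Prop :=
  ∀ w, p.coord w ≠ 0 → w = u ∨ w = v

/-- `PLPath p q ℓ`: there is a piecewise linear path of length `ℓ` from `p` to `q`. Each linear piece
stays in one closed edge `[u, v]`, which is isometric to `[0, 1]` through the coordinate at `v`. -/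
inductive PLPath : GraphRealization Γ → GraphRealization Γ → ENNReal → Prop
  | refl (p : GraphRealization Γ) : PLPath p p 0
  | cons {p q r : GraphRealization Γ} {u v : V} {ℓ : ENNReal} (huv : Γ.Adj u v)
      (hp : p.LiesOn u v) (hq : q.LiesOn u v) (h : PLPath q r ℓ) :
      PLPath p r (edist (p.coord v) (q.coord v) + ℓ)

theorem PLPath.trans {p q r : GraphRealization Γ} {a b : ENNReal} (h : PLPath p q a)
    (h' : PLPath q r b) : PLPath p r (a + b) := by
  induction h with
  | refl p => simpa using h'
  | cons huv hp hq _ ih => rw [add_assoc]; exact PLPath.cons huv hp hq (ih h')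

theorem PLPath.symm {p q : GraphRealization Γ} {a : ENNReal} (h : PLPath p q a) : PLPath q p a := by
  induction h with
  | refl p => exact PLPath.refl p
  | @cons p q r u v ℓ huv hp hq _ ih =>
    have h1 : PLPath q p (edist (q.coord v) (p.coord v) + 0) :=
      PLPath.cons huv hq hp (PLPath.refl p)
    rw [add_zero, edist_comm] at h1
    rw [add_comm]
    exact ih.trans h1

/-- The path metric on the realization (with value `∞` between distinct components). -/
noncomputable instance : PseudoEMetricSpace (GraphRealization Γ) where
  edist p q := ⨅ (ℓ : ENNReal) (_ : PLPath p q ℓ), ℓ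
  edist_self p := le_antisymm (iInf₂_le 0 (PLPath.refl p)) bot_le
  edist_comm p q := le_antisymm
    (le_iInf₂ fun ℓ h => iInf₂_le ℓ h.symm) (le_iInf₂ fun ℓ h => iInf₂_le ℓ h.symm)
  edist_triangle p q r := by
    simp only [ENNReal.iInf_add, ENNReal.add_iInf]
    exact le_iInf₂ fun b hb => le_iInf₂ fun a ha => iInf₂_le (a + b) (ha.trans hb)

theorem edist_def (p q : GraphRealization Γ) :
    edist p q = ⨅ (ℓ : ENNReal) (_ : PLPath p q ℓ), ℓ := rfl

end GraphRealization

/-- The group `G`, acting on the vertices, acts by automorphisms of the graph `Γ`. -/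
class ActsOnGraph (G : Type*) {V : Type*} [Group G] [MulAction G V] (Γ : SimpleGraph V) :
    Prop where
  adj_smul : ∀ (g : G) (u v : V), Γ.Adj u v → Γ.Adj (g • u) (g • v)

namespace GraphRealization

variable {G V : Type*} [Group G] [MulAction G V] {Γ : SimpleGraph V} [ActsOnGraph G Γ]

/-- The affine extension of the action to the realization: `(g • p)(v) = p(g⁻¹ • v)`. -/
noncomputable instance : SMul G (GraphRealization Γ) where
  smul g p :=
    { coord := Finsupp.equivMapDomain (MulAction.toPerm g) p.coord
      nonneg := fun v => by simpa using p.nonneg _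
      sum_eq_one := by
        rw [Finsupp.sum_equivMapDomain]; exact p.sum_eq_one
      cell := by
        obtain ⟨u, v, huv, h⟩ := p.cell
        refine ⟨g • u, g • v, ?_, fun w hw => ?_⟩
        · rcases huv with rfl | huv
          · exact Or.inl rfl
          · exact Or.inr (ActsOnGraph.adj_smul g u v huv)
        · simpa [inv_smul_eq_iff] using h (g⁻¹ • w) (by simpa using hw) }

theorem coord_smul (g : G) (p : GraphRealization Γ) (v : V) :
    (g • p).coord v = p.coord (g⁻¹ • v) := rfl

noncomputable instance : MulAction G (GraphRealization Γ) where
  one_smul p := by ext v; simp [coord_smul]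
  mul_smul g h p := by ext v; simp [coord_smul, mul_smul]

theorem LiesOn.smul {p : GraphRealization Γ} {u v : V} (h : p.LiesOn u v) (g : G) :
    (g • p).LiesOn (g • u) (g • v) := fun w hw => by
  simpa [inv_smul_eq_iff] using h (g⁻¹ • w) hw

theorem PLPath.smul {p q : GraphRealization Γ} {a : ENNReal} (h : PLPath p q a) (g : G) :
    PLPath (g • p) (g • q) a := by
  induction h with
  | refl p => exact PLPath.refl _
  | @cons p q r u v ℓ huv hp hq _ ih =>
    have := PLPath.cons (ActsOnGraph.adj_smul g u v huv) (hp.smul g) (hq.smul g) ih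
    simpa [coord_smul] using this

instance : IsIsometricSMul G (GraphRealization Γ) where
  isometry_smul g p q := le_antisymm
    (le_iInf₂ fun ℓ h => iInf₂_le ℓ (h.smul g))
    (le_iInf₂ fun ℓ h => iInf₂_le ℓ (by simpa using h.smul g⁻¹))

end GraphRealization

/-! ### The Bass-Serre tree of a group with two subgroups -/

/-- The graph with vertices the left cosets `fA` and `fB`, and one edge between `fA` and `fB` for
each left coset `f(A ∩ B)`. It is a tree if and only if `G` is the amalgamated product of `A` and `B`
along `A ∩ B`. -/
def bassSerreGraph {G : Type*} [Group G] (A B : Subgroup G) :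
    SimpleGraph ((G ⧸ A) ⊕ (G ⧸ B)) where
  Adj u v := ∃ f : G,
    (u = Sum.inl (f : G ⧸ A) ∧ v = Sum.inr (f : G ⧸ B)) ∨
    (v = Sum.inl (f : G ⧸ A) ∧ u = Sum.inr (f : G ⧸ B))
  symm := ⟨fun _ _ ⟨f, h⟩ => ⟨f, h.symm⟩⟩
  loopless := ⟨fun u ⟨f, h⟩ => by rcases h with ⟨h, h'⟩ | ⟨h, h'⟩ <;> simp [h] at h'⟩

instance {G : Type*} [Group G] (A B : Subgroup G) : ActsOnGraph G (bassSerreGraph A B) where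
  adj_smul g u v := by
    rintro ⟨f, ⟨rfl, rfl⟩ | ⟨rfl, rfl⟩⟩
    · exact ⟨g * f, Or.inl ⟨rfl, rfl⟩⟩
    · exact ⟨g * f, Or.inr ⟨rfl, rfl⟩⟩

/-! ### Polynomial automorphisms of the affine plane -/

section PlaneAut

/-- The group of polynomial automorphisms of the affine plane over `k`, with the composition
`(f * g)(x, y) = f(g(x, y))`. An automorphism `f = (f₁, f₂)` is given by the automorphism
`P ↦ P ∘ f` of the algebra `k[x, y]`; this correspondence reverses products. -/
def PlaneAut (k : Type*) [Field k] : Type _ :=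
  (MvPolynomial (Fin 2) k ≃ₐ[k] MvPolynomial (Fin 2) k)ᵐᵒᵖ

namespace PlaneAut

variable {k : Type*} [Field k]

noncomputable instance : Group (PlaneAut k) :=
  inferInstanceAs (Group (MvPolynomial (Fin 2) k ≃ₐ[k] MvPolynomial (Fin 2) k)ᵐᵒᵖ)

/-- The pull-back `P ↦ P ∘ f`. -/
def pullback (f : PlaneAut k) : MvPolynomial (Fin 2) k ≃ₐ[k] MvPolynomial (Fin 2) k :=
  MulOpposite.unop f

/-- The components of `f = (f₁, f₂)`. -/
noncomputable def comp (f : PlaneAut k) (i : Fin 2) : MvPolynomial (Fin 2) k :=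
  f.pullback (X i)

theorem pullback_mul (f g : PlaneAut k) (P : MvPolynomial (Fin 2) k) :
    (f * g).pullback P = g.pullback (f.pullback P) := rfl

theorem pullback_inv_pullback (f : PlaneAut k) (P : MvPolynomial (Fin 2) k) :
    f⁻¹.pullback (f.pullback P) = P := by
  rw [← pullback_mul, mul_inv_cancel]; rfl

/-- The polynomial automorphism with components `p 0, p 1`, whose inverse has components
`q 0, q 1`. -/
noncomputable def ofComp (p q : Fin 2 → MvPolynomial (Fin 2) k)
    (h : ∀ i, aeval p (q i) = X i) (h' : ∀ i, aeval q (p i) = X i) : PlaneAut k :=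
  MulOpposite.op (AlgEquiv.ofAlgHom (aeval p) (aeval q)
    (by ext1 i; simpa using h i) (by ext1 i; simpa using h' i))

theorem comp_ofComp (p q : Fin 2 → MvPolynomial (Fin 2) k)
    (h : ∀ i, aeval p (q i) = X i) (h' : ∀ i, aeval q (p i) = X i) (i : Fin 2) :
    (ofComp p q h h').comp i = p i := by
  change aeval p (X i) = p i
  simp

/-- The subgroup of affine automorphisms `(ax + by + e, cx + dy + e')`, `ad - bc ≠ 0`. -/
noncomputable def affine (k : Type*) [Field k] : Subgroup (PlaneAut k) where
  carrier := {f | ∃ a b c d e e' : k, a * d - b * c ≠ 0 ∧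
    f.comp 0 = C a * X 0 + C b * X 1 + C e ∧ f.comp 1 = C c * X 0 + C d * X 1 + C e'}
  one_mem' := ⟨1, 0, 0, 1, 0, 0, by simp, by simp; rfl, by simp; rfl⟩
  mul_mem' := by
    rintro f g ⟨a, b, c, d, e, e', hf, hf0, hf1⟩ ⟨a₂, b₂, c₂, d₂, e₂, e₂', hg, hg0, hg1⟩
    refine ⟨a * a₂ + b * c₂, a * b₂ + b * d₂, c * a₂ + d * c₂, c * b₂ + d * d₂,
      a * e₂ + b * e₂' + e, c * e₂ + d * e₂' + e', ?_, ?_, ?_⟩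
    · have := mul_ne_zero hf hg
      intro h
      apply this
      linear_combination h
    · have h : (f * g).comp 0 = g.pullback (f.comp 0) := rfl
      have h0 : g.pullback (X 0) = _ := hg0
      have h1 : g.pullback (X 1) = _ := hg1
      have hC : ∀ r : k, g.pullback (C r) = C r := fun r => g.pullback.commutes r
      rw [h, hf0]
      simp only [map_add, map_mul, h0, h1, hC]
      ring
    · have h : (f * g).comp 1 = g.pullback (f.comp 1) := rfl
      have h0 : g.pullback (X 0) = _ := hg0
      have h1 : g.pullback (X 1) = _ := hg1
      have hC : ∀ r : k, g.pullback (C r) = C r := fun r => g.pullback.commutes r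
      rw [h, hf1]
      simp only [map_add, map_mul, h0, h1, hC]
      ring
  inv_mem' := by
    rintro f ⟨a, b, c, d, e, e', hf, hf0, hf1⟩
    have hC : ∀ r : k, f⁻¹.pullback (C r) = C r := fun r => f⁻¹.pullback.commutes r
    have e0 : (X 0 : MvPolynomial (Fin 2) k) = C a * f⁻¹.comp 0 + C b * f⁻¹.comp 1 + C e := by
      have := congrArg f⁻¹.pullback hf0
      simpa only [comp, pullback_inv_pullback, map_add, map_mul, hC] using this
    have e1 : (X 1 : MvPolynomial (Fin 2) k) = C c * f⁻¹.comp 0 + C d * f⁻¹.comp 1 + C e' := by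
      have := congrArg f⁻¹.pullback hf1
      simpa only [comp, pullback_inv_pullback, map_add, map_mul, hC] using this
    obtain ⟨r, hr⟩ : ∃ r, r * (a * d - b * c) = 1 := ⟨_, inv_mul_cancel₀ hf⟩
    have hr' : C r * (C a * C d - C b * C c) = (1 : MvPolynomial (Fin 2) k) := by
      simp only [← C_mul, ← C_sub, hr, C_1]
    refine ⟨r * d, -(r * b), -(r * c), r * a, r * (b * e' - d * e), r * (c * e - a * e'),
      ?_, ?_, ?_⟩
    · intro h
      have : r * (r * (a * d - b * c)) = 0 := by linear_combination h
      rw [hr, mul_one] at this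
      simp [this] at hr
    · simp only [C_mul, C_sub, C_neg]
      linear_combination (-f⁻¹.comp 0) * hr' - C r * C d * e0 + C r * C b * e1
    · simp only [C_mul, C_sub, C_neg]
      linear_combination (-f⁻¹.comp 1) * hr' + C r * C c * e0 - C r * C a * e1

/-- The subgroup of elementary automorphisms `(ax + P(y), by + c)`, `ab ≠ 0`. -/
noncomputable def elementary (k : Type*) [Field k] : Subgroup (PlaneAut k) where
  carrier := {f | ∃ (a b c : k) (P : Polynomial k), a * b ≠ 0 ∧
    f.comp 0 = C a * X 0 + Polynomial.aeval (X 1) P ∧ f.comp 1 = C b * X 1 + C c}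
  one_mem' := ⟨1, 1, 0, 0, by simp, by simp; rfl, by simp; rfl⟩
  mul_mem' := by
    rintro f g ⟨a, b, c, P, hf, hf0, hf1⟩ ⟨a₂, b₂, c₂, P₂, hg, hg0, hg1⟩
    have h0 : g.pullback (X 0) = _ := hg0
    have h1 : g.pullback (X 1) = _ := hg1
    have hC : ∀ r : k, g.pullback (C r) = C r := fun r => g.pullback.commutes r
    refine ⟨a * a₂, b * b₂, b * c₂ + c,
      Polynomial.C a * P₂ + P.comp (Polynomial.C b₂ * Polynomial.X + Polynomial.C c₂), ?_, ?_, ?_⟩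
    · have := mul_ne_zero hf hg
      intro h
      apply this
      linear_combination h
    · have h : (f * g).comp 0 = g.pullback (f.comp 0) := rfl
      rw [h, hf0]
      simp only [map_add, map_mul, h0, hC, ← Polynomial.aeval_algHom_apply,
        Polynomial.aeval_comp, Polynomial.aeval_C, Polynomial.aeval_X, h1,
        MvPolynomial.algebraMap_eq]
      ring
    · have h : (f * g).comp 1 = g.pullback (f.comp 1) := rfl
      rw [h, hf1]
      simp only [map_add, map_mul, h1, hC]
      ring
  inv_mem' := by
    rintro f ⟨a, b, c, P, hf, hf0, hf1⟩
    have hC : ∀ r : k, f⁻¹.pullback (C r) = C r := fun r => f⁻¹.pullback.commutes r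
    have e1 : (X 1 : MvPolynomial (Fin 2) k) = C b * f⁻¹.comp 1 + C c := by
      have := congrArg f⁻¹.pullback hf1
      simpa only [comp, pullback_inv_pullback, map_add, map_mul, hC] using this
    have e0 : (X 0 : MvPolynomial (Fin 2) k) =
        C a * f⁻¹.comp 0 + Polynomial.aeval (f⁻¹.comp 1) P := by
      have := congrArg f⁻¹.pullback hf0
      simpa only [comp, pullback_inv_pullback, map_add, map_mul, hC,
        ← Polynomial.aeval_algHom_apply] using this
    have ha : C a⁻¹ * C a = (1 : MvPolynomial (Fin 2) k) := by
      rw [← C_mul, inv_mul_cancel₀ (left_ne_zero_of_mul hf), C_1]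
    have hb : C b⁻¹ * C b = (1 : MvPolynomial (Fin 2) k) := by
      rw [← C_mul, inv_mul_cancel₀ (right_ne_zero_of_mul hf), C_1]
    have f1 : f⁻¹.comp 1 = C b⁻¹ * X 1 + C (-(b⁻¹ * c)) := by
      simp only [C_mul, C_neg]
      linear_combination (-f⁻¹.comp 1) * hb - C b⁻¹ * e1
    refine ⟨a⁻¹, b⁻¹, -(b⁻¹ * c), -(Polynomial.C a⁻¹ *
      P.comp (Polynomial.C b⁻¹ * Polynomial.X + Polynomial.C (-(b⁻¹ * c)))), ?_, ?_, f1⟩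
    · exact mul_ne_zero (inv_ne_zero (left_ne_zero_of_mul hf))
        (inv_ne_zero (right_ne_zero_of_mul hf))
    · have : Polynomial.aeval (X 1 : MvPolynomial (Fin 2) k) (-(Polynomial.C a⁻¹ *
          P.comp (Polynomial.C b⁻¹ * Polynomial.X + Polynomial.C (-(b⁻¹ * c))))) =
          -(C a⁻¹ * Polynomial.aeval (f⁻¹.comp 1) P) := by
        simp only [map_neg, map_add, map_mul, Polynomial.aeval_comp, Polynomial.aeval_C,
          Polynomial.aeval_X, MvPolynomial.algebraMap_eq, f1]
      rw [this]
      linear_combination (-f⁻¹.comp 0) * ha - C a⁻¹ * e0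

/-- The (realization of the) Bass-Serre tree of `Aut(k²)`, seen as the amalgamated product of its
affine and elementary subgroups. -/
abbrev Tree (k : Type*) [Field k] : Type _ :=
  GraphRealization (bassSerreGraph (affine k) (elementary k))

/-- The automorphism `(x² - y, x)`, with inverse `(y, y² - x)`. -/
noncomputable def henon (k : Type*) [Field k] : PlaneAut k :=
  ofComp ![X 0 ^ 2 - X 1, X 0] ![X 1, X 1 ^ 2 - X 0]
    (by intro i; fin_cases i <;> simp) (by intro i; fin_cases i <;> simp)

/-- The automorphism `(ax, by)`, for `a, b ∈ k*`. -/
noncomputable def diag (a b : kˣ) : PlaneAut k :=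
  ofComp ![C (a : k) * X 0, C (b : k) * X 1]
    ![C ((a⁻¹ : kˣ) : k) * X 0, C ((b⁻¹ : kˣ) : k) * X 1]
    (by intro i; fin_cases i <;> simp [← mul_assoc, ← C_mul])
    (by intro i; fin_cases i <;> simp [← mul_assoc, ← C_mul])

end PlaneAut

end PlaneAut

/-! Everything rests on degrees. Put the height `2 * deg f⁻¹` on `fA` and `2 * deg (f⁻¹)₂ + 1` on
`fB`. Every vertex has at most one neighbour that is not higher, so a highest vertex of a cycle
cannot exist and the Bass-Serre graph is a forest (`isAcyclic_bassSerreGraph`). Connectedness is not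
needed: distances are allowed to be infinite.

Loxodromic: `g⁻ⁿ` has degree `2 ^ n`, whereas the powers of an element of a conjugate of `A` or `B`
have bounded degree, so `g` fixes no vertex. An automorphism of a forest that preserves types and
fixes no vertex moves every point by at least `2` (`two_le_edist_smul`). The ray `A, B, gA, gB, ...`
realizes this bound, and it is unbounded.

WPD: if `h` moves two far apart points of the ray by little, then the ray and its image share a
middle segment (`exists_common_segment`). Up to powers of `g` on both sides, `h` then fixes eight
consecutive vertices of the ray. Comparing coefficients, such an element is `(ax, a²y)` with `a⁴ =
a`, provided `2 ≠ 0` (`finite_stabilizer`).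

Not tight: `f` satisfies `f³ = 1` and commutes with `g²`, and this alone makes it fix the axis of
`g` pointwise. At a vertex `f₁A` of the axis, `g` is conjugate to a map `(q(x) - δy, x)`, and a
degree count shows that an element of order dividing `3` commuting with the square of such a map is
affine (`IsHenon.mem_affine_of_commute`). A vertex of type `B` on the axis is the only common
neighbour of two vertices of type `A` on it. Hence `g` and `fgf⁻¹` have the same unbounded axis,
while `fgf⁻¹` is neither `g` nor `g⁻¹`. -/

namespace SimpleGraph

/-! ### Distances and cycles in graphs. -/

variable {V : Type*} {Γ : SimpleGraph V}

theorem abs_dist_sub_dist_le_one (w : V) {a b : V} (h : Γ.Adj a b) :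
    |(Γ.dist w a : ℝ) - Γ.dist w b| ≤ 1 := by
  -- `Γ.dist` is `0` on unreachable pairs; adjacent vertices are reachable from `w` or unreachable
  -- together.
  by_cases hr : Γ.Reachable w a
  · have h1 := hr.dist_triangle_left b
    have h2 := (hr.trans h.reachable).dist_triangle_left a
    rw [dist_eq_one_iff_adj.2 h] at h1
    rw [dist_eq_one_iff_adj.2 h.symm] at h2
    have h1' : (Γ.dist w b : ℝ) ≤ Γ.dist w a + 1 := by exact_mod_cast h1
    have h2' : (Γ.dist w a : ℝ) ≤ Γ.dist w b + 1 := by exact_mod_cast h2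
    rw [abs_le]
    constructor <;> linarith
  · rw [dist_eq_zero_of_not_reachable hr,
      dist_eq_zero_of_not_reachable fun h' => hr (h'.trans h.symm.reachable)]
    simp

/-- At a highest vertex of a cycle, the two neighbours along the cycle would be distinct and not
higher. -/
theorem isAcyclic_of_height (ht : V → ℕ)
    (H : ∀ v w w', Γ.Adj v w → Γ.Adj v w' → ht w ≤ ht v → ht w' ≤ ht v → w = w') :
    Γ.IsAcyclic := by
  classical
  intro x c hc
  obtain ⟨m, hm, hmax⟩ := c.support.toFinset.exists_max_image ht ⟨x, by simp⟩
  simp only [List.mem_toFinset] at hm hmax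
  have hc' := hc.rotate hm
  have hsupp : ∀ w ∈ (c.rotate m hm).support, ht w ≤ ht m := by
    intro w hw
    exact hmax w ((Walk.mem_support_rotate_iff _ _ hm).1 hw)
  refine hc'.snd_ne_penultimate (H m _ _ ?_ ?_ ?_ ?_)
  · exact Walk.adj_snd hc'.not_nil
  · exact (Walk.adj_penultimate hc'.not_nil).symm
  · exact hsupp _ (Walk.getVert_mem_support _ _)
  · exact hsupp _ (Walk.getVert_mem_support _ _)

theorem IsAcyclic.eq_of_adj_adj (hΓ : Γ.IsAcyclic) {a b c d : V} (hab : Γ.Adj a b)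
    (hcb : Γ.Adj c b) (had : Γ.Adj a d) (hcd : Γ.Adj c d) (hbd : b ≠ d) : a = c := by
  by_contra hac
  let p : Γ.Walk b d := .cons hab.symm (.cons had .nil)
  let q : Γ.Walk b d := .cons hcb.symm (.cons hcd .nil)
  have hp : p.IsPath := by
    simp [p, Walk.isPath_def, hbd, hab.ne', had.ne]
  have hq : q.IsPath := by
    simp [q, Walk.isPath_def, hbd, hcb.ne', hcd.ne]
  have := congrArg (fun r : Γ.Path b d => (r : Γ.Walk b d).support) ((hΓ.subsingleton_path _ _).elim ⟨p, hp⟩ ⟨q, hq⟩)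
  simp [p, q] at this
  exact hac this

/-! ### Rays in forests -/

theorem exists_ray_path {v : ℕ → V} (hadj : ∀ i, Γ.Adj (v i) (v (i + 1)))
    (hinj : Function.Injective v) (n : ℕ) :
    ∃ p : Γ.Walk (v 0) (v n), p.IsPath ∧ p.length = n ∧
      ∀ w, w ∈ p.support ↔ ∃ i ≤ n, w = v i := by
  induction n with
  | zero => exact ⟨.nil, by simp, by simp, by simp⟩
  | succ n ih =>
    obtain ⟨p, hp, hl, hs⟩ := ih
    refine ⟨p.concat (hadj n), ?_, by simp [hl], fun w => ?_⟩
    · refine hp.concat (fun h => ?_) _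
      obtain ⟨i, hi, h⟩ := (hs _).1 h
      have := hinj h
      omega
    · rw [Walk.support_concat]
      simp only [List.mem_append, hs, List.mem_singleton]
      constructor
      · rintro (⟨i, hi, rfl⟩ | rfl)
        · exact ⟨i, by omega, rfl⟩
        · exact ⟨n + 1, le_rfl, rfl⟩
      · rintro ⟨i, hi, rfl⟩
        rcases Nat.lt_or_ge n i with h | h
        · right; rw [show i = n + 1 by omega]
        · exact Or.inl ⟨i, h, rfl⟩

/-- Any walk shortens to a path, and the segment of the ray is the only path between its ends. -/
theorem IsAcyclic.mem_support_of_ray (hΓ : Γ.IsAcyclic) {v : ℕ → V}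
    (hadj : ∀ i, Γ.Adj (v i) (v (i + 1))) (hinj : Function.Injective v) {n i : ℕ} (hi : i ≤ n)
    (q : Γ.Walk (v 0) (v n)) : v i ∈ q.support := by
  classical
  obtain ⟨p, hp, -, hs⟩ := exists_ray_path hadj hinj n
  have h := congrArg (fun r : Γ.Path (v 0) (v n) => (r : Γ.Walk (v 0) (v n)).support)
    ((hΓ.subsingleton_path _ _).elim q.toPath ⟨p, hp⟩)
  apply q.support_toPath_subset_support
  simp only at h
  rw [h]
  exact (hs _).2 ⟨i, hi, rfl⟩

theorem IsAcyclic.dist_ray (hΓ : Γ.IsAcyclic) {v : ℕ → V}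
    (hadj : ∀ i, Γ.Adj (v i) (v (i + 1))) (hinj : Function.Injective v) (m n : ℕ) :
    Γ.dist (v m) (v (m + n)) = n := by
  obtain ⟨p, hp, hl, -⟩ := exists_ray_path (v := fun i => v (m + i)) (fun i => hadj _)
    (fun a b h => by have := hinj h; omega) n
  obtain ⟨q, hq, hq'⟩ := p.reachable.exists_path_of_dist
  have h := (hΓ.subsingleton_path _ _).elim (⟨p, hp⟩ : Γ.Path _ _) ⟨q, hq⟩
  have : p = q := congrArg Subtype.val h
  subst this
  exact hq'.symm.trans hl

theorem dist_le_of_mem_support {a b w : V} (c : Γ.Walk a b) (h : w ∈ c.support) :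
    Γ.dist a w ≤ c.length := by
  classical
  exact (dist_le (c.takeUntil w h)).trans (c.length_takeUntil_le_length h)

/-- Two rays in a forest which start close to each other: if they meet far from the start, then
the points of the first one between its start and the meeting point are on the second one. -/
theorem IsAcyclic.exists_eq_of_ray_meet (hΓ : Γ.IsAcyclic) {v v' : ℕ → V}
    (hadj : ∀ i, Γ.Adj (v i) (v (i + 1))) (hinj : Function.Injective v)
    (hadj' : ∀ i, Γ.Adj (v' i) (v' (i + 1))) (hinj' : Function.Injective v')
    {E : ℕ} (c : Γ.Walk (v 0) (v' 0)) (hc : c.length ≤ E) {i i' j' : ℕ} (hi : E < i)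
    (hii : i ≤ i') (h : v i' = v' j') : ∃ j ≤ j', v i = v' j := by
  obtain ⟨p, -, -, hs⟩ := exists_ray_path hadj' hinj' j'
  have hmem := hΓ.mem_support_of_ray hadj hinj hii ((c.append p).copy rfl h.symm)
  rw [Walk.support_copy, Walk.mem_support_append_iff] at hmem
  rcases hmem with hmem | hmem
  · have h1 := dist_le_of_mem_support c hmem
    have h2 := hΓ.dist_ray hadj hinj 0 i
    rw [zero_add] at h2
    omega
  · exact (hs _).1 hmem

/-- The detour through `c`, the second ray and `d` must pass through `v i`. This vertex is too far
from `v 0` to be on `c`, and too far from `v M` to be on `d`. -/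
theorem IsAcyclic.exists_eq_of_ray_close (hΓ : Γ.IsAcyclic) {v v' : ℕ → V}
    (hadj : ∀ i, Γ.Adj (v i) (v (i + 1))) (hinj : Function.Injective v)
    (hadj' : ∀ i, Γ.Adj (v' i) (v' (i + 1))) (hinj' : Function.Injective v')
    {E M : ℕ} (c : Γ.Walk (v 0) (v' 0)) (hc : c.length ≤ E) (d : Γ.Walk (v M) (v' M))
    (hd : d.length ≤ E) {i : ℕ} (hi : E < i) (hiM : i + E < M) : ∃ j ≤ M, v i = v' j := by
  obtain ⟨p, -, -, hs⟩ := exists_ray_path hadj' hinj' M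
  have hmem := hΓ.mem_support_of_ray hadj hinj (show i ≤ M by omega)
    ((c.append p).append d.reverse)
  rw [Walk.mem_support_append_iff, Walk.mem_support_append_iff, Walk.support_reverse,
    List.mem_reverse] at hmem
  rcases hmem with (hmem | hmem) | hmem
  · have h1 := dist_le_of_mem_support c hmem
    have h2 := hΓ.dist_ray hadj hinj 0 i
    rw [zero_add] at h2
    omega
  · exact (hs _).1 hmem
  · have h1 := dist_le_of_mem_support d hmem
    have h2 := hΓ.dist_ray hadj hinj i (M - i)
    rw [show i + (M - i) = M by omega, dist_comm] at h2
    omega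

/-- Two rays in a forest which start close to each other and meet far from the start have a long
common segment. -/
theorem IsAcyclic.exists_common_segment (hΓ : Γ.IsAcyclic) {v v' : ℕ → V}
    (hadj : ∀ i, Γ.Adj (v i) (v (i + 1))) (hinj : Function.Injective v)
    (hadj' : ∀ i, Γ.Adj (v' i) (v' (i + 1))) (hinj' : Function.Injective v')
    {E : ℕ} (c : Γ.Walk (v 0) (v' 0)) (hc : c.length ≤ E) {i : ℕ} (hi : E < i) (t : ℕ) :
    ∀ j, v (i + t) = v' j → ∃ l, j = l + t ∧ ∀ s ≤ t, v (i + s) = v' (l + s) := by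
  induction t with
  | zero =>
    intro j hj
    refine ⟨j, rfl, fun s hs => ?_⟩
    rw [show s = 0 by omega]
    exact hj
  | succ t ih =>
    intro j hj
    obtain ⟨l, hl, hl'⟩ := hΓ.exists_eq_of_ray_meet hadj hinj hadj' hinj' c hc
      (show E < i + t by omega) (show i + t ≤ i + (t + 1) by omega) hj
    have h1 : Γ.dist (v' l) (v' j) = 1 := by
      rw [dist_eq_one_iff_adj, ← hl', ← hj]
      exact hadj _
    have h2 := hΓ.dist_ray hadj' hinj' l (j - l)
    rw [show l + (j - l) = j by omega] at h2
    obtain ⟨l₀, rfl, hs⟩ := ih l hl'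
    obtain rfl : j = l₀ + (t + 1) := by omega
    refine ⟨l₀, rfl, fun s hst => ?_⟩
    rcases Nat.lt_or_ge t s with h | h
    · rw [show s = t + 1 by omega]
      exact hj
    · exact hs s h

end SimpleGraph

/-! ### Lipschitz functions on the realization of a graph. -/

namespace GraphRealization

variable {V : Type*} {Γ : SimpleGraph V}

/-- The affine extension of a function on the vertices. -/
noncomputable def eval (φ : V → ℝ) (p : GraphRealization Γ) : ℝ :=
  p.coord.sum fun v a => a * φ v

theorem LiesOn.eval_eq {p : GraphRealization Γ} {u v : V} (h : p.LiesOn u v) (huv : u ≠ v)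
    (φ : V → ℝ) : eval φ p = p.coord u * φ u + p.coord v * φ v := by
  classical
  rw [eval, Finsupp.sum_of_support_subset (s := {u, v}), Finset.sum_pair huv]
  · intro w hw
    simpa using h w (by simpa using hw)
  · simp

theorem LiesOn.coord_add {p : GraphRealization Γ} {u v : V} (h : p.LiesOn u v) (huv : u ≠ v) :
    p.coord u + p.coord v = 1 := by
  have := h.eval_eq huv (fun _ => 1)
  rw [eval] at this
  simp only [mul_one] at this
  rw [← this]
  exact p.sum_eq_one

theorem LiesOn.eval_self {p : GraphRealization Γ} {u : V} (h : p.LiesOn u u)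
    (φ : V → ℝ) : p.coord u = 1 ∧ eval φ p = φ u := by
  classical
  have key : ∀ φ : V → ℝ, eval φ p = p.coord u * φ u := by
    intro φ
    rw [eval, Finsupp.sum_of_support_subset (s := {u}), Finset.sum_singleton]
    · intro w hw
      simpa using h w (by simpa using hw)
    · simp
  have h1 := key (fun _ => 1)
  rw [eval] at h1
  simp only [mul_one] at h1
  have h2 : p.coord u = 1 := by rw [← h1]; exact p.sum_eq_one
  exact ⟨h2, by rw [key, h2, one_mul]⟩

theorem exists_coord_ne_zero (p : GraphRealization Γ) : ∃ u, p.coord u ≠ 0 := by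
  by_contra! h
  have : p.coord = 0 := by ext v; exact h v
  have h2 := p.sum_eq_one
  simp [this] at h2

/-- The affine extension of a `1`-Lipschitz function on the vertices is `1`-Lipschitz. -/
theorem PLPath.eval_sub_le {φ : V → ℝ} (hφ : ∀ a b, Γ.Adj a b → |φ a - φ b| ≤ 1)
    {p q : GraphRealization Γ} {ℓ : ENNReal} (h : PLPath p q ℓ) :
    ENNReal.ofReal (eval φ q - eval φ p) ≤ ℓ := by
  induction h with
  | refl p => simp
  | @cons p q r u v ℓ huv hp hq _ ih =>
    have h1 : eval φ r - eval φ p = (eval φ q - eval φ p) + (eval φ r - eval φ q) := by ring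
    rw [h1]
    refine ENNReal.ofReal_add_le.trans (add_le_add ?_ ih)
    rw [edist_dist]
    apply ENNReal.ofReal_le_ofReal
    rw [hp.eval_eq huv.ne, hq.eval_eq huv.ne, Real.dist_eq]
    have hp' := hp.coord_add huv.ne
    have hq' := hq.coord_add huv.ne
    have h2 : q.coord u * φ u + q.coord v * φ v - (p.coord u * φ u + p.coord v * φ v) =
        (p.coord v - q.coord v) * (φ u - φ v) := by
      linear_combination (-φ u) * hp' + φ u * hq'
    rw [h2]
    calc _ ≤ |(p.coord v - q.coord v) * (φ u - φ v)| := le_abs_self _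
      _ = |p.coord v - q.coord v| * |φ u - φ v| := abs_mul _ _
      _ ≤ |p.coord v - q.coord v| * 1 := by gcongr; exact hφ _ _ huv
      _ = _ := mul_one _

theorem reachable_of_coord_ne_zero (p : GraphRealization Γ) {a b : V} (ha : p.coord a ≠ 0)
    (hb : p.coord b ≠ 0) : Γ.Reachable a b := by
  obtain ⟨u, v, huv, h⟩ := p.cell
  have huv' : Γ.Reachable u v := by
    rcases huv with rfl | huv
    · rfl
    · exact huv.reachable
  rcases h a ha with rfl | rfl <;> rcases h b hb with rfl | rfl <;>
    first | rfl | exact huv' | exact huv'.symm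

theorem PLPath.reachable {p q : GraphRealization Γ} {ℓ : ENNReal} (h : PLPath p q ℓ) :
    ∀ {a b : V}, p.coord a ≠ 0 → q.coord b ≠ 0 → Γ.Reachable a b := by
  induction h with
  | refl p => exact p.reachable_of_coord_ne_zero
  | @cons p q r u v ℓ huv hp hq _ ih =>
    intro a b ha hb
    obtain ⟨w, hw⟩ := q.exists_coord_ne_zero
    refine SimpleGraph.Reachable.trans ?_ (ih hw hb)
    rcases hp a ha with rfl | rfl <;> rcases hq w hw with rfl | rfl <;>
    first | rfl | exact huv.reachable | exact huv.reachable.symm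

theorem eval_sub_le_edist {φ : V → ℝ} (hφ : ∀ a b, Γ.Adj a b → |φ a - φ b| ≤ 1)
    (p q : GraphRealization Γ) : ENNReal.ofReal (eval φ q - eval φ p) ≤ edist p q := by
  rw [edist_def]
  exact le_iInf₂ fun ℓ h => h.eval_sub_le hφ

theorem reachable_of_edist_ne_top {p q : GraphRealization Γ} (h : edist p q ≠ ⊤) {a b : V}
    (ha : p.coord a ≠ 0) (hb : q.coord b ≠ 0) : Γ.Reachable a b := by
  by_contra hab
  apply h
  rw [edist_def]
  simp only [iInf_eq_top]
  exact fun ℓ hℓ => absurd (hℓ.reachable ha hb) hab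

/-- A vertex, as a point of the realization. -/
noncomputable def ofVertex (Γ : SimpleGraph V) (v : V) : GraphRealization Γ where
  coord := Finsupp.single v 1
  nonneg w := by
    classical
    rw [Finsupp.single_apply]; split_ifs <;> norm_num
  sum_eq_one := by simp
  cell := ⟨v, v, Or.inl rfl, fun w hw => by
    classical
    rw [Finsupp.single_apply] at hw
    left
    by_contra h
    exact hw (if_neg (fun h' => h h'.symm))⟩

theorem coord_ofVertex_self (v : V) : (ofVertex Γ v).coord v = 1 := by simp [ofVertex]

theorem coord_ofVertex_of_ne {v w : V} (h : w ≠ v) : (ofVertex Γ v).coord w = 0 := by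
  classical
  simp [ofVertex, h.symm]

theorem liesOn_ofVertex_left (u v : V) : (ofVertex Γ u).LiesOn u v := fun w hw => by
  by_contra! h
  exact hw (coord_ofVertex_of_ne h.1)

theorem liesOn_ofVertex_right (u v : V) : (ofVertex Γ v).LiesOn u v := fun w hw => by
  by_contra! h
  exact hw (coord_ofVertex_of_ne h.2)

theorem eval_ofVertex (φ : V → ℝ) (v : V) : eval φ (ofVertex Γ v) = φ v := by
  simp [eval, ofVertex]

theorem smul_ofVertex {G : Type*} [Group G] [MulAction G V] [ActsOnGraph G Γ] (g : G) (v : V) :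
    g • ofVertex Γ v = ofVertex Γ (g • v) := by
  ext w
  rw [coord_smul]
  by_cases h : w = g • v
  · subst h
    simp [coord_ofVertex_self]
  · rw [coord_ofVertex_of_ne h, coord_ofVertex_of_ne]
    rwa [Ne, inv_smul_eq_iff]

theorem edist_ofVertex_le_one {u v : V} (h : Γ.Adj u v) :
    edist (ofVertex Γ u) (ofVertex Γ v) ≤ 1 := by
  have := PLPath.cons h (liesOn_ofVertex_left u v) (liesOn_ofVertex_right u v) (PLPath.refl _)
  rw [edist_def]
  refine (iInf₂_le _ this).trans ?_
  rw [coord_ofVertex_self, coord_ofVertex_of_ne h.ne', edist_dist]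
  simp

/-- The distance to `u` is a `1`-Lipschitz function on the vertices, so its affine extension bounds
the path metric from below. -/
theorem dist_le_edist_ofVertex (u v : V) :
    (Γ.dist u v : ENNReal) ≤ edist (ofVertex Γ u) (ofVertex Γ v) := by
  have := eval_sub_le_edist (fun a b h => SimpleGraph.abs_dist_sub_dist_le_one u h)
    (ofVertex Γ u) (ofVertex Γ v)
  simpa [eval_ofVertex] using this

theorem exists_walk_length_le {u v : V} {E : ℕ}
    (h : edist (ofVertex Γ u) (ofVertex Γ v) ≤ E) : ∃ c : Γ.Walk u v, c.length ≤ E := by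
  -- Reachability must be known first: otherwise `Γ.dist u v` could be the default value `0`.
  have hr : Γ.Reachable u v := reachable_of_edist_ne_top
    (ne_top_of_le_ne_top (ENNReal.natCast_ne_top E) h)
    (by rw [coord_ofVertex_self]; exact one_ne_zero)
    (by rw [coord_ofVertex_self]; exact one_ne_zero)
  obtain ⟨c, hc⟩ := hr.exists_walk_length_eq_dist
  refine ⟨c, ?_⟩
  rw [hc]
  exact_mod_cast (dist_le_edist_ofVertex u v).trans h

theorem smul_eq_self_of_fix {G : Type*} [Group G] [MulAction G V] [ActsOnGraph G Γ] {g : G}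
    {p : GraphRealization Γ} (h : ∀ u, p.coord u ≠ 0 → g • u = u) : g • p = p := by
  ext w
  rw [coord_smul]
  by_cases hw : p.coord w = 0
  · by_cases hw' : p.coord (g⁻¹ • w) = 0
    · rw [hw, hw']
    · have := h _ hw'
      rw [smul_inv_smul] at this
      rw [← this]
  · have := h w hw
    rw [inv_smul_eq_iff.2 this.symm]

/-! ### Displacement of automorphisms of bipartite forests -/

section Displacement

variable {G : Type*} [Group G] [MulAction G V]

/-- The distance is nonzero, and even since types are preserved. -/
theorem two_le_dist_smul (c : Γ.Coloring Bool) {g : G} (hc : ∀ v : V, c (g • v) = c v)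
    (hfix : ∀ v : V, g • v ≠ v) {v : V} (hr : Γ.Reachable v (g • v)) : 2 ≤ Γ.dist v (g • v) := by
  obtain ⟨w, hw⟩ := hr.exists_walk_length_eq_dist
  have h1 : Even w.length := (c.even_length_iff_congr w).2 (by rw [hc])
  have h2 := hr.pos_dist_of_ne (hfix v).symm
  rw [hw] at h1
  obtain ⟨k, hk⟩ := h1
  omega

variable [ActsOnGraph G Γ]

/-- Both distances are odd. If both were `1`, then `u, v, gu, gv` would form a `4`-cycle. -/
theorem three_le_dist_smul (hΓ : Γ.IsAcyclic) (c : Γ.Coloring Bool) {g : G}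
    (hc : ∀ v : V, c (g • v) = c v) (hfix : ∀ v : V, g • v ≠ v) {u v : V} (huv : Γ.Adj u v)
    (hr : Γ.Reachable u (g • u)) : 3 ≤ Γ.dist u (g • v) ∨ 3 ≤ Γ.dist v (g • u) := by
  have hguv := ActsOnGraph.adj_smul g u v huv
  have hodd : ∀ {a b : V}, Γ.Adj a b → Γ.Reachable a (g • b) → Γ.dist a (g • b) = 1 ∨
      3 ≤ Γ.dist a (g • b) := by
    intro a b hab hr
    obtain ⟨w, hw⟩ := hr.exists_walk_length_eq_dist
    have h1 := c.odd_length_iff_not_congr w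
    rw [hc] at h1
    have h2 : Odd w.length := h1.2 (by
      have := c.valid hab
      revert this
      cases c a <;> cases c b <;> simp)
    rw [hw] at h2
    obtain ⟨k, hk⟩ := h2
    omega
  rcases hodd huv (hr.trans hguv.reachable) with h1 | h1
  · rcases hodd huv.symm (huv.symm.reachable.trans hr) with h2 | h2
    · rw [SimpleGraph.dist_eq_one_iff_adj] at h1 h2
      exact absurd (hΓ.eq_of_adj_adj huv h2.symm h1 hguv (hfix v).symm) (hfix u).symm
    · exact Or.inr h2
  · exact Or.inl h1

/-- The displacement of `p` is bounded below by testing against the distances to the ends of the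
edge of `p`, and minus the distances to the ends of its image. The second conclusion says that the
vertices spanning a point of the axis are displaced by exactly `2`. -/
theorem displacement_aux (hΓ : Γ.IsAcyclic) (c : Γ.Coloring Bool) {g : G}
    (hc : ∀ v : V, c (g • v) = c v) (hfix : ∀ v : V, g • v ≠ v) (p : GraphRealization Γ)
    (hp : edist p (g • p) ≠ ⊤) :
    2 ≤ edist p (g • p) ∧
      (edist p (g • p) ≤ 2 → ∀ u, p.coord u ≠ 0 → Γ.dist u (g • u) = 2) := by
  have lip : ∀ (φ : V → ℝ), (∀ a b, Γ.Adj a b → |φ a - φ b| ≤ 1) →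
      eval φ (g • p) - eval φ p ≤ (edist p (g • p)).toReal := fun φ hφ => by
    rw [← ENNReal.ofReal_le_iff_le_toReal hp]
    exact eval_sub_le_edist hφ p (g • p)
  set D := (edist p (g • p)).toReal with hD
  have hD2 : 2 ≤ D → 2 ≤ edist p (g • p) := fun h => by
    rw [← ENNReal.ofReal_toReal hp, ← hD]
    simpa using ENNReal.ofReal_le_ofReal h
  have hD2' : edist p (g • p) ≤ 2 → D ≤ 2 := fun h => by
    simpa using ENNReal.toReal_mono (by simp) h
  have l1 : ∀ w a b, Γ.Adj a b → |(Γ.dist w a : ℝ) - Γ.dist w b| ≤ 1 :=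
    fun w a b h => SimpleGraph.abs_dist_sub_dist_le_one w h
  have l2 : ∀ w a b, Γ.Adj a b → |-(Γ.dist w a : ℝ) - -(Γ.dist w b : ℝ)| ≤ 1 :=
    fun w a b h => by
      rw [← abs_neg]
      convert l1 w a b h using 2
      ring
  have hreach : ∀ u, p.coord u ≠ 0 → Γ.Reachable u (g • u) := fun u hu =>
    reachable_of_edist_ne_top hp hu (by rwa [coord_smul, inv_smul_smul])
  obtain ⟨u, v, huv, hl⟩ := p.cell
  have hl : p.LiesOn u v := hl
  have hgl := hl.smul g
  rcases huv with rfl | huv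
  · obtain ⟨hu, -⟩ := hl.eval_self (fun _ => 0)
    have hr := hreach u (by rw [hu]; exact one_ne_zero)
    have h1 := lip _ (l1 u)
    rw [(hl.eval_self _).2, (hgl.eval_self _).2, SimpleGraph.dist_self] at h1
    have h2 := two_le_dist_smul c hc hfix hr
    have h2' : (2 : ℝ) ≤ Γ.dist u (g • u) := by exact_mod_cast h2
    push_cast at h1
    refine ⟨hD2 (by linarith), fun h w hw => ?_⟩
    obtain rfl : w = u := by simpa using hl w hw
    have h3 := hD2' h
    have h4 : (Γ.dist w (g • w) : ℝ) ≤ 2 := by linarith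
    have h5 : Γ.dist w (g • w) ≤ 2 := by exact_mod_cast h4
    omega
  · have hguv := ActsOnGraph.adj_smul g u v huv
    have hr : Γ.Reachable u (g • u) := by
      obtain ⟨w, hw⟩ := p.exists_coord_ne_zero
      rcases hl w hw with rfl | rfl
      · exact hreach _ hw
      · exact (huv.reachable.trans (hreach _ hw)).trans hguv.symm.reachable
    have hr' : Γ.Reachable v (g • v) :=
      (huv.symm.reachable.trans hr).trans hguv.reachable
    have hn := two_le_dist_smul c hc hfix hr
    have hm := two_le_dist_smul c hc hfix hr'
    have hab := three_le_dist_smul hΓ c hc hfix huv hr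
    have e1 := lip _ (l1 u)
    have e2 := lip _ (l1 v)
    have e3 := lip _ (l2 (g • u))
    have e4 := lip _ (l2 (g • v))
    rw [hl.eval_eq huv.ne, hgl.eval_eq hguv.ne, coord_smul, coord_smul, inv_smul_smul,
      inv_smul_smul] at e1 e2 e3 e4
    have hs := hl.coord_add huv.ne
    have hu0 := p.nonneg u
    have hv0 := p.nonneg v
    rw [SimpleGraph.dist_self, SimpleGraph.dist_eq_one_iff_adj.2 huv] at e1
    rw [SimpleGraph.dist_self, SimpleGraph.dist_eq_one_iff_adj.2 huv.symm] at e2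
    rw [SimpleGraph.dist_self, SimpleGraph.dist_eq_one_iff_adj.2 hguv,
      SimpleGraph.dist_comm (u := g • u) (v := u), SimpleGraph.dist_comm (u := g • u) (v := v)] at e3
    rw [SimpleGraph.dist_self, SimpleGraph.dist_eq_one_iff_adj.2 hguv.symm,
      SimpleGraph.dist_comm (u := g • v) (v := u), SimpleGraph.dist_comm (u := g • v) (v := v)] at e4
    push_cast at e1 e2 e3 e4
    set n := Γ.dist u (g • u)
    set m := Γ.dist v (g • v)
    set a := Γ.dist u (g • v)
    set b := Γ.dist v (g • u)
    set x := p.coord u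
    set y := p.coord v
    have hn' : (2 : ℝ) ≤ n := by exact_mod_cast hn
    have hm' : (2 : ℝ) ≤ m := by exact_mod_cast hm
    -- If `a ≥ 3`, these come from `e1` and `e4`; if `b ≥ 3`, from `e3` and `e2`. As `x + y = 1` and
    -- `n, m ≥ 2`, they give `D ≥ 2`, and `D ≤ 2` forces `n = 2` if `x > 0` and `m = 2` if `y > 0`.
    have key : x * n + y * 2 ≤ D ∧ x * 2 + y * m ≤ D := by
      rcases hab with ha | hb
      · have ha' : (3 : ℝ) ≤ a := by exact_mod_cast ha
        constructor <;> nlinarith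
      · have hb' : (3 : ℝ) ≤ b := by exact_mod_cast hb
        constructor <;> nlinarith
    refine ⟨hD2 (by nlinarith [key.1]), fun h w hw => ?_⟩
    have h3 := hD2' h
    rcases hl w hw with rfl | rfl
    · have hx : 0 < x := lt_of_le_of_ne hu0 (Ne.symm hw)
      have h4 : (n : ℝ) ≤ 2 := by
        by_contra! h4
        nlinarith [key.1]
      have h5 : n ≤ 2 := by exact_mod_cast h4
      omega
    · have hx : 0 < y := lt_of_le_of_ne hv0 (Ne.symm hw)
      have h4 : (m : ℝ) ≤ 2 := by
        by_contra! h4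
        nlinarith [key.2]
      have h5 : m ≤ 2 := by exact_mod_cast h4
      omega

/-- A type preserving automorphism of a bipartite forest without fixed vertices moves all points by
at least `2`. -/
theorem two_le_edist_smul (hΓ : Γ.IsAcyclic) (c : Γ.Coloring Bool) {g : G}
    (hc : ∀ v : V, c (g • v) = c v) (hfix : ∀ v : V, g • v ≠ v) (p : GraphRealization Γ) :
    2 ≤ edist p (g • p) := by
  by_cases hp : edist p (g • p) = ⊤
  · rw [hp]; exact le_top
  · exact (displacement_aux hΓ c hc hfix p hp).1

theorem dist_smul_eq_two_of_edist_le (hΓ : Γ.IsAcyclic) (c : Γ.Coloring Bool) {g : G}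
    (hc : ∀ v : V, c (g • v) = c v) (hfix : ∀ v : V, g • v ≠ v) {p : GraphRealization Γ}
    (hp : edist p (g • p) ≤ 2) {u : V} (hu : p.coord u ≠ 0) : Γ.dist u (g • u) = 2 :=
  (displacement_aux hΓ c hc hfix p (ne_top_of_le_ne_top (by simp) hp)).2 hp u hu

end Displacement

end GraphRealization

/-! ### Degrees of polynomials under substitution. -/

namespace MvPolynomial

variable {k : Type*} [Field k]

theorem totalDegree_C_mul {σ : Type*} {a : k} (ha : a ≠ 0) (P : MvPolynomial σ k) :
    (C a * P).totalDegree = P.totalDegree := by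
  by_cases hP : P = 0
  · simp [hP]
  · rw [totalDegree_mul_of_isDomain (by simpa using ha) hP, totalDegree_C, zero_add]

theorem totalDegree_C_mul_le {σ : Type*} (a : k) (P : MvPolynomial σ k) :
    (C a * P).totalDegree ≤ P.totalDegree :=
  (totalDegree_mul _ _).trans (by simp)

theorem totalDegree_add_C {σ : Type*} (P : MvPolynomial σ k) (e : k) :
    (P + C e).totalDegree = P.totalDegree := by
  rcases Nat.eq_zero_or_pos P.totalDegree with h | h
  · rw [totalDegree_eq_zero_iff_eq_C] at h
    rw [h, ← C_add, totalDegree_C, totalDegree_C]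
  · exact totalDegree_add_eq_left_of_totalDegree_lt (by simpa using h)

theorem totalDegree_aeval_polynomial {σ : Type*} {Q : MvPolynomial σ k} (hQ : 1 ≤ Q.totalDegree)
    (P : Polynomial k) :
    (Polynomial.aeval Q P).totalDegree = P.natDegree * Q.totalDegree := by
  -- The nonvanishing is carried through the induction, since degrees add only for nonzero factors.
  -- The induction is Horner's scheme: `P = divX P * X + const`.
  suffices h : ∀ n, ∀ P : Polynomial k, P.natDegree = n → P ≠ 0 → Polynomial.aeval Q P ≠ 0 ∧
      (Polynomial.aeval Q P).totalDegree = P.natDegree * Q.totalDegree by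
    by_cases hP : P = 0
    · simp [hP]
    · exact (h _ P rfl hP).2
  have hQ0 : Q ≠ 0 := by rintro rfl; simp at hQ
  intro n
  induction n with
  | zero =>
    intro P hP hP0
    rw [Polynomial.eq_C_of_natDegree_eq_zero hP] at hP0 ⊢
    simp only [Polynomial.aeval_C, algebraMap_eq]
    simpa using hP0
  | succ n ih =>
    intro P hP hP0
    have hd : P.divX.natDegree = n := by rw [Polynomial.natDegree_divX_eq_natDegree_tsub_one, hP]; rfl
    have hd0 : P.divX ≠ 0 := by
      rw [Ne, Polynomial.divX_eq_zero_iff]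
      intro h
      rw [h, Polynomial.natDegree_C] at hP
      omega
    obtain ⟨h1, h2⟩ := ih _ hd hd0
    have h3 : (Polynomial.aeval Q P).totalDegree = P.natDegree * Q.totalDegree := by
      conv_lhs => rw [← Polynomial.divX_mul_X_add P]
      rw [map_add, map_mul, Polynomial.aeval_X, Polynomial.aeval_C, algebraMap_eq,
        totalDegree_add_C, totalDegree_mul_of_isDomain h1 hQ0, h2, hd, hP]
      ring
    refine ⟨fun h => ?_, h3⟩
    rw [h, totalDegree_zero, hP] at h3
    have : 0 < (n + 1) * Q.totalDegree := by positivity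
    omega

theorem totalDegree_aeval_le_of_support {p : Fin 2 → MvPolynomial (Fin 2) k} {e₀ e₁ N : ℕ}
    (h₀ : (p 0).totalDegree ≤ e₀) (h₁ : (p 1).totalDegree ≤ e₁) {R : MvPolynomial (Fin 2) k}
    (hR : ∀ s ∈ R.support, s 0 * e₀ + s 1 * e₁ ≤ N) : (aeval p R).totalDegree ≤ N := by
  rw [aeval_def, eval₂_eq]
  refine totalDegree_finsetSum_le fun s hs => ?_
  rw [algebraMap_eq]
  refine (totalDegree_C_mul_le _ _).trans ?_
  refine (totalDegree_finsetProd _ _).trans ((Finset.sum_le_sum fun i _ =>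
    totalDegree_pow (p i) (s i)).trans ?_)
  refine le_trans ?_ (hR s hs)
  calc ∑ i ∈ s.support, s i * (p i).totalDegree ≤ ∑ i, s i * (p i).totalDegree :=
        Finset.sum_le_univ_sum_of_nonneg fun _ => Nat.zero_le _
    _ ≤ _ := by
      rw [Fin.sum_univ_two]
      gcongr

theorem degree_le_totalDegree {R : MvPolynomial (Fin 2) k} {s : Fin 2 →₀ ℕ} (hs : s ∈ R.support) :
    s 0 + s 1 ≤ R.totalDegree := by
  have := le_totalDegree hs
  rwa [Finsupp.sum_fintype _ _ (fun _ => rfl), Fin.sum_univ_two] at this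

theorem totalDegree_aeval_le {p : Fin 2 → MvPolynomial (Fin 2) k} {N : ℕ}
    (h : ∀ i, (p i).totalDegree ≤ N) (R : MvPolynomial (Fin 2) k) :
    (aeval p R).totalDegree ≤ R.totalDegree * N := by
  refine totalDegree_aeval_le_of_support (h 0) (h 1) fun s hs => ?_
  rw [← add_mul]
  exact Nat.mul_le_mul_right _ (degree_le_totalDegree hs)

/-- Substitution of polynomials of different degrees: only the power of the first variable can reach
the maximal degree. -/
theorem exists_aeval_eq_add {p : Fin 2 → MvPolynomial (Fin 2) k}
    (hp : (p 1).totalDegree < (p 0).totalDegree) {R : MvPolynomial (Fin 2) k}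
    (hR : 1 ≤ R.totalDegree) :
    ∃ S, aeval p R = C (coeff (Finsupp.single 0 R.totalDegree) R) * p 0 ^ R.totalDegree + S ∧
      S.totalDegree < R.totalDegree * (p 0).totalDegree := by
  set D := R.totalDegree
  set c := coeff (Finsupp.single 0 D) R with hc
  -- The remainder comes from all monomials of `R` other than the pure power of the first variable;
  -- `c` may be zero.
  refine ⟨aeval p (R - monomial (Finsupp.single 0 D) c), ?_, ?_⟩
  · rw [map_sub, aeval_monomial, algebraMap_eq]
    simp
  · have hpos : 0 < D * (p 0).totalDegree := Nat.mul_pos hR (by omega)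
    suffices h : (aeval p (R - monomial (Finsupp.single 0 D) c)).totalDegree ≤
        D * (p 0).totalDegree - 1 by omega
    refine totalDegree_aeval_le_of_support le_rfl le_rfl fun s hs => ?_
    rw [mem_support_iff, coeff_sub, coeff_monomial] at hs
    have hne : s ≠ Finsupp.single 0 D := by
      rintro rfl
      simp [hc] at hs
    rw [if_neg hne.symm, sub_zero, ← mem_support_iff] at hs
    have hle := degree_le_totalDegree hs
    suffices h : s 0 * (p 0).totalDegree + s 1 * (p 1).totalDegree < D * (p 0).totalDegree by omega
    rcases Nat.eq_zero_or_pos (s 1) with h1 | h1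
    · have h0 : s 0 ≠ D := by
        intro h0
        apply hne
        ext i
        fin_cases i
        · simpa using h0
        · simpa using h1
      have : s 0 < D := by omega
      rw [h1, zero_mul, add_zero]
      exact Nat.mul_lt_mul_of_pos_right this (by omega)
    · calc s 0 * (p 0).totalDegree + s 1 * (p 1).totalDegree
          < s 0 * (p 0).totalDegree + s 1 * (p 0).totalDegree := by gcongr
        _ = (s 0 + s 1) * (p 0).totalDegree := by ring
        _ ≤ _ := Nat.mul_le_mul_right _ hle

theorem totalDegree_pow_of_isDomain {σ : Type*} (P : MvPolynomial σ k) (n : ℕ) :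
    (P ^ n).totalDegree = n * P.totalDegree := by
  by_cases hP : P = 0
  · subst hP
    cases n <;> simp
  · induction n with
    | zero => simp
    | succ n ih =>
      rw [pow_succ, totalDegree_mul_of_isDomain (pow_ne_zero _ hP) hP, ih]
      ring

theorem totalDegree_aeval_eq {p : Fin 2 → MvPolynomial (Fin 2) k}
    (hp : (p 1).totalDegree < (p 0).totalDegree) {R : MvPolynomial (Fin 2) k}
    (hR : 1 ≤ R.totalDegree) (hc : coeff (Finsupp.single 0 R.totalDegree) R ≠ 0) :
    (aeval p R).totalDegree = R.totalDegree * (p 0).totalDegree := by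
  obtain ⟨S, hS, hd⟩ := exists_aeval_eq_add hp hR
  rw [hS, totalDegree_add_eq_left_of_totalDegree_lt] <;>
    rw [totalDegree_C_mul hc, totalDegree_pow_of_isDomain]
  exact hd

theorem coeff_ne_zero_of_totalDegree_aeval {p : Fin 2 → MvPolynomial (Fin 2) k}
    (hp : (p 1).totalDegree < (p 0).totalDegree) {R : MvPolynomial (Fin 2) k}
    (hR : 1 ≤ R.totalDegree)
    (h : (aeval p R).totalDegree = R.totalDegree * (p 0).totalDegree) :
    coeff (Finsupp.single 0 R.totalDegree) R ≠ 0 := by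
  intro hc
  obtain ⟨S, hS, hd⟩ := exists_aeval_eq_add hp hR
  rw [hc, C_0, zero_mul, zero_add] at hS
  rw [hS] at h
  omega

theorem exists_eq_of_totalDegree_le_one {R : MvPolynomial (Fin 2) k} (hR : R.totalDegree ≤ 1) :
    ∃ a b e : k, R = C a * X 0 + C b * X 1 + C e := by
  refine ⟨coeff (Finsupp.single 0 1) R, coeff (Finsupp.single 1 1) R, coeff 0 R, ?_⟩
  ext s
  simp only [coeff_add, coeff_C_mul, coeff_X, coeff_C]
  by_cases h : s ∈ R.support
  · have hs := (degree_le_totalDegree h).trans hR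
    have hcases : s = 0 ∨ s = Finsupp.single 0 1 ∨ s = Finsupp.single 1 1 := by
      simp only [Finsupp.ext_iff, Fin.forall_fin_two]
      simp
      omega
    rcases hcases with rfl | rfl | rfl <;> simp [Finsupp.ext_iff]
  · rw [notMem_support_iff] at h
    rw [h]
    split_ifs with h0 h1 h2 h1 h2 h2 <;> try subst h0
    all_goals first | (subst h2; simp_all) | simp_all

end MvPolynomial

/-! ### The degree of a plane automorphism. -/

namespace PlaneAut

variable {k : Type*} [Field k]

theorem pullback_C (f : PlaneAut k) (r : k) : f.pullback (C r) = C r := f.pullback.commutes r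

theorem pullback_eq_aeval (f : PlaneAut k) (P : MvPolynomial (Fin 2) k) :
    f.pullback P = aeval f.comp P := by
  have : (f.pullback : MvPolynomial (Fin 2) k →ₐ[k] MvPolynomial (Fin 2) k) = aeval f.comp := by
    ext1 i
    simp [comp]
  exact congrArg (fun φ => φ P) this

theorem comp_mul (f g : PlaneAut k) (i : Fin 2) : (f * g).comp i = g.pullback (f.comp i) := rfl

theorem comp_one (i : Fin 2) : (1 : PlaneAut k).comp i = X i := rfl

theorem pullback_polynomial (f : PlaneAut k) (Q : MvPolynomial (Fin 2) k) (P : Polynomial k) :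
    f.pullback (Polynomial.aeval Q P) = Polynomial.aeval (f.pullback Q) P :=
  (Polynomial.aeval_algHom_apply f.pullback Q P).symm

theorem ext_comp {f g : PlaneAut k} (h0 : f.comp 0 = g.comp 0) (h1 : f.comp 1 = g.comp 1) :
    f = g := by
  have h : f.comp = g.comp := by
    funext i
    fin_cases i
    · exact h0
    · exact h1
  apply MulOpposite.unop_injective
  apply AlgEquiv.ext
  intro P
  change f.pullback P = g.pullback P
  rw [pullback_eq_aeval, pullback_eq_aeval, h]

theorem pullback_ne_C (f : PlaneAut k) {P : MvPolynomial (Fin 2) k} (hP : ∀ r, P ≠ C r) (r : k) :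
    f.pullback P ≠ C r := by
  intro h
  apply hP r
  apply f.pullback.injective
  rw [h, pullback_C]

theorem X_ne_C (i : Fin 2) (r : k) : (X i : MvPolynomial (Fin 2) k) ≠ C r := by
  intro h
  have := congrArg totalDegree h
  simp at this

theorem one_le_totalDegree_comp (f : PlaneAut k) (i : Fin 2) : 1 ≤ (f.comp i).totalDegree := by
  by_contra! h
  exact f.pullback_ne_C (X_ne_C i) _ (totalDegree_eq_zero_iff_eq_C.1 (Nat.lt_one_iff.1 h))

/-- The degree of a polynomial automorphism. -/
noncomputable def degree (f : PlaneAut k) : ℕ := max (f.comp 0).totalDegree (f.comp 1).totalDegree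

theorem totalDegree_comp_le_degree (f : PlaneAut k) (i : Fin 2) :
    (f.comp i).totalDegree ≤ f.degree := by
  fin_cases i
  · exact le_max_left _ _
  · exact le_max_right _ _

theorem one_le_degree (f : PlaneAut k) : 1 ≤ f.degree :=
  (f.one_le_totalDegree_comp 0).trans (f.totalDegree_comp_le_degree 0)

theorem totalDegree_pullback_le (f : PlaneAut k) (P : MvPolynomial (Fin 2) k) :
    (f.pullback P).totalDegree ≤ P.totalDegree * f.degree := by
  rw [pullback_eq_aeval]
  exact totalDegree_aeval_le f.totalDegree_comp_le_degree P

theorem degree_mul_le (f g : PlaneAut k) : (f * g).degree ≤ f.degree * g.degree := by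
  have : ∀ i, ((f * g).comp i).totalDegree ≤ f.degree * g.degree := fun i => by
    rw [comp_mul]
    exact (g.totalDegree_pullback_le _).trans
      (Nat.mul_le_mul_right _ (f.totalDegree_comp_le_degree i))
  exact max_le (this 0) (this 1)

theorem totalDegree_linear_le (P Q : MvPolynomial (Fin 2) k) (a b e : k) :
    (C a * P + C b * Q + C e).totalDegree ≤ max P.totalDegree Q.totalDegree := by
  rw [totalDegree_add_C]
  exact (totalDegree_add _ _).trans
    (max_le_max (totalDegree_C_mul_le _ _) (totalDegree_C_mul_le _ _))

theorem linear_eq_C {a b r : k} (h : (C a * X 0 + C b * X 1 : MvPolynomial (Fin 2) k) = C r) :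
    a = 0 ∧ b = 0 := by
  have h0 := congrArg (coeff (Finsupp.single 0 1)) h
  have h1 := congrArg (coeff (Finsupp.single 1 1)) h
  simp [coeff_C_mul, coeff_X, coeff_C, Finsupp.ext_iff] at h0 h1
  exact ⟨h0, h1⟩

theorem mem_affine_iff_degree_le {f : PlaneAut k} : f ∈ affine k ↔ f.degree ≤ 1 := by
  constructor
  · rintro ⟨a, b, c, d, e, e', -, h0, h1⟩
    refine max_le ?_ ?_
    · rw [h0]
      exact (totalDegree_linear_le _ _ _ _ _).trans (by simp)
    · rw [h1]
      exact (totalDegree_linear_le _ _ _ _ _).trans (by simp)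
  · intro h
    obtain ⟨a, b, e, h0⟩ :=
      exists_eq_of_totalDegree_le_one ((f.totalDegree_comp_le_degree 0).trans h)
    obtain ⟨c, d, e', h1⟩ :=
      exists_eq_of_totalDegree_le_one ((f.totalDegree_comp_le_degree 1).trans h)
    refine ⟨a, b, c, d, e, e', fun hdet => ?_, h0, h1⟩
    -- The components of an automorphism satisfy no nontrivial affine relation, as `X 0` and `X 1`
    -- do not. A vanishing determinant would give one.
    have key : ∀ u v w : k, (C u * f.comp 0 + C v * f.comp 1 : MvPolynomial (Fin 2) k) = C w →
        u = 0 ∧ v = 0 := by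
      intro u v w huv
      apply linear_eq_C (r := w)
      apply f.pullback.injective
      simp only [map_add, map_mul, pullback_C]
      exact huv
    have hdetC : (C a * C d - C b * C c : MvPolynomial (Fin 2) k) = 0 := by
      rw [← C_mul, ← C_mul, ← C_sub, hdet, C_0]
    have k1 := key d (-b) (d * e - b * e') (by
      rw [h0, h1]
      simp only [C_neg, C_sub, C_mul]
      linear_combination (X 0) * hdetC)
    have k2 := key (-c) a (a * e' - c * e) (by
      rw [h0, h1]
      simp only [C_neg, C_sub, C_mul]
      linear_combination (X 1) * hdetC)
    have hb : b = 0 := by simpa using k1.2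
    apply f.pullback_ne_C (X_ne_C 0) e
    change f.comp 0 = C e
    rw [h0, k2.2, hb]
    simp

theorem mem_elementary_of_affine {f : PlaneAut k} {a b c d e e' : k} (hdet : a * d - b * c ≠ 0)
    (h0 : f.comp 0 = C a * X 0 + C b * X 1 + C e)
    (h1 : f.comp 1 = C c * X 0 + C d * X 1 + C e') (hc : c = 0) : f ∈ elementary k := by
  subst hc
  refine ⟨a, d, e', Polynomial.C b * Polynomial.X + Polynomial.C e, by simpa using hdet, ?_, ?_⟩
  · rw [h0]
    simp [algebraMap_eq, add_assoc]
  · rw [h1]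
    simp

theorem mem_affine_of_elementary {f : PlaneAut k} {a b c : k} {P : Polynomial k} (hab : a * b ≠ 0)
    (h0 : f.comp 0 = C a * X 0 + Polynomial.aeval (X 1) P)
    (h1 : f.comp 1 = C b * X 1 + C c) (hP : P.natDegree ≤ 1) : f ∈ affine k := by
  rw [Polynomial.eq_X_add_C_of_natDegree_le_one hP] at h0
  refine ⟨a, P.coeff 1, 0, b, P.coeff 0, c, by simpa using hab, ?_, ?_⟩
  · rw [h0]
    simp [algebraMap_eq, add_assoc]
  · rw [h1]
    simp

/-! ### The Bass-Serre graph is a forest -/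

theorem degree_affine_mul {a f : PlaneAut k} (ha : a ∈ affine k) : (a * f).degree = f.degree := by
  have key : ∀ {a f : PlaneAut k}, a ∈ affine k → (a * f).degree ≤ f.degree := by
    intro a f ha
    refine (degree_mul_le a f).trans ?_
    have := mem_affine_iff_degree_le.1 ha
    calc a.degree * f.degree ≤ 1 * f.degree := Nat.mul_le_mul_right _ this
      _ = _ := one_mul _
  refine le_antisymm (key ha) ?_
  have := key (f := a * f) ((affine k).inv_mem ha)
  rwa [inv_mul_cancel_left] at this

/-- With `degree_affine_mul`, this makes `height` independent of the coset representatives. -/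
theorem totalDegree_elementary_mul {b f : PlaneAut k} (hb : b ∈ elementary k) :
    ((b * f).comp 1).totalDegree = (f.comp 1).totalDegree := by
  obtain ⟨a, b', c, P, hab, h0, h1⟩ := hb
  rw [comp_mul, h1, map_add, map_mul, pullback_C, pullback_C, totalDegree_add_C,
    totalDegree_C_mul (right_ne_zero_of_mul hab)]
  rfl

/-- A height function on the vertices of the Bass-Serre graph. -/
noncomputable def height : (PlaneAut k ⧸ affine k) ⊕ (PlaneAut k ⧸ elementary k) → ℕ
  | Sum.inl q => 2 * (q.out)⁻¹.degree
  | Sum.inr q => 2 * ((q.out)⁻¹.comp 1).totalDegree + 1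

theorem height_inl (f : PlaneAut k) :
    height (Sum.inl (f : PlaneAut k ⧸ affine k)) = 2 * f⁻¹.degree := by
  obtain ⟨a, ha⟩ := QuotientGroup.mk_out_eq_mul (affine k) f
  rw [height, ha, mul_inv_rev, degree_affine_mul ((affine k).inv_mem a.2)]

theorem height_inr (f : PlaneAut k) :
    height (Sum.inr (f : PlaneAut k ⧸ elementary k)) = 2 * (f⁻¹.comp 1).totalDegree + 1 := by
  obtain ⟨a, ha⟩ := QuotientGroup.mk_out_eq_mul (elementary k) f
  rw [height, ha, mul_inv_rev, totalDegree_elementary_mul ((elementary k).inv_mem a.2)]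

/-- A vertex of type `A` has at most one lower neighbour. If the affine map `f'⁻¹f` had a nonzero
`x`-coefficient in its second component, then `(f'⁻¹)₂` would inherit the full degree of `f⁻¹`. -/
theorem mk_elementary_eq_of_totalDegree_lt {f f' : PlaneAut k}
    (h : (f : PlaneAut k ⧸ affine k) = f') (h1 : (f⁻¹.comp 1).totalDegree < f⁻¹.degree)
    (h1' : (f'⁻¹.comp 1).totalDegree < f⁻¹.degree) : (f : PlaneAut k ⧸ elementary k) = f' := by
  rw [QuotientGroup.eq] at h ⊢
  have h' := (affine k).inv_mem h
  rw [mul_inv_rev, inv_inv] at h'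
  obtain ⟨a, b, c, d, e, e', hdet, h0, hc1⟩ := h'
  have hc : c = 0 := by
    by_contra hc
    have e1 : f'⁻¹.comp 1 = C c * f⁻¹.comp 0 + C d * f⁻¹.comp 1 + C e' := by
      rw [show f'⁻¹ = f'⁻¹ * f * f⁻¹ by group, comp_mul, hc1]
      simp only [map_add, map_mul, pullback_C]
      rfl
    have hd0 : (f⁻¹.comp 0).totalDegree = f⁻¹.degree := by
      rw [degree] at h1 ⊢
      omega
    rw [e1, totalDegree_add_C, totalDegree_add_eq_left_of_totalDegree_lt,
      totalDegree_C_mul hc] at h1'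
    · omega
    · rw [totalDegree_C_mul hc, hd0]
      exact (totalDegree_C_mul_le _ _).trans_lt h1
  have := (elementary k).inv_mem (mem_elementary_of_affine hdet h0 hc1 hc)
  rwa [mul_inv_rev, inv_inv] at this

/-- A vertex of type `B` has at most one lower neighbour. Here `(f'⁻¹)₁ = a (f⁻¹)₁ + P((f⁻¹)₂)`, and
a `P` of degree at least `2` would exceed the degree bound. -/
theorem mk_affine_eq_of_degree_le {f f' : PlaneAut k}
    (h : (f : PlaneAut k ⧸ elementary k) = f') (h1 : f⁻¹.degree ≤ (f⁻¹.comp 1).totalDegree)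
    (h1' : f'⁻¹.degree ≤ (f⁻¹.comp 1).totalDegree) : (f : PlaneAut k ⧸ affine k) = f' := by
  rw [QuotientGroup.eq] at h ⊢
  have h' := (elementary k).inv_mem h
  rw [mul_inv_rev, inv_inv] at h'
  obtain ⟨a, b, c, P, hab, h0, hc1⟩ := h'
  have hP : P.natDegree ≤ 1 := by
    have e0 : f'⁻¹.comp 0 = C a * f⁻¹.comp 0 + Polynomial.aeval (f⁻¹.comp 1) P := by
      rw [show f'⁻¹ = f'⁻¹ * f * f⁻¹ by group, comp_mul, h0]
      simp only [map_add, map_mul, pullback_C, pullback_polynomial]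
      rfl
    have e2 : Polynomial.aeval (f⁻¹.comp 1) P = f'⁻¹.comp 0 - C a * f⁻¹.comp 0 := by
      rw [e0]; ring
    have e3 := (totalDegree_sub (f'⁻¹.comp 0) (C a * f⁻¹.comp 0)).trans
      (max_le ((totalDegree_comp_le_degree _ 0).trans h1')
        (((totalDegree_C_mul_le _ _).trans (totalDegree_comp_le_degree _ 0)).trans h1))
    have hpos := f⁻¹.one_le_totalDegree_comp 1
    rw [← e2, totalDegree_aeval_polynomial hpos] at e3
    by_contra! hP
    nlinarith
  have := (affine k).inv_mem (mem_affine_of_elementary hab h0 hc1 hP)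
  rwa [mul_inv_rev, inv_inv] at this

theorem isAcyclic_bassSerreGraph :
    (bassSerreGraph (affine k) (elementary k)).IsAcyclic := by
  refine SimpleGraph.isAcyclic_of_height height ?_
  rintro v w w' ⟨f, ⟨rfl, rfl⟩ | ⟨rfl, rfl⟩⟩ ⟨f', ⟨h, rfl⟩ | ⟨rfl, h⟩⟩ hw hw'
  · rw [Sum.inl.injEq] at h
    rw [height_inl, height_inr] at hw hw'
    rw [mk_elementary_eq_of_totalDegree_lt h (by omega) (by omega)]
  · simp at h
  · simp at h
  · rw [Sum.inr.injEq] at h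
    rw [height_inl, height_inr] at hw hw'
    rw [mk_affine_eq_of_degree_le h (by omega) (by omega)]

/-- The type of a vertex of the Bass-Serre graph. -/
def typeColoring {G : Type*} [Group G] (A B : Subgroup G) : (bassSerreGraph A B).Coloring Bool :=
  SimpleGraph.Coloring.mk (Sum.elim (fun _ => true) fun _ => false) (by
    rintro v w ⟨f, ⟨rfl, rfl⟩ | ⟨rfl, rfl⟩⟩ <;> simp)

theorem typeColoring_smul {G : Type*} [Group G] (A B : Subgroup G) (g : G)
    (v : (G ⧸ A) ⊕ (G ⧸ B)) : typeColoring A B (g • v) = typeColoring A B v := by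
  rcases v with v | v <;> rfl

end PlaneAut

namespace PlaneAut

variable {k : Type*} [Field k]

/-! ### Hénon automorphisms and automorphisms commuting with their squares -/

/-- `h = (q(x) - δy, x)`, with `q` of degree at least `2`. -/
structure IsHenon (h : PlaneAut k) (q : Polynomial k) (δ : k) : Prop where
  two_le : 2 ≤ q.natDegree
  ne_zero : δ ≠ 0
  comp_zero : h.comp 0 = Polynomial.aeval (X 0) q - C δ * X 1
  comp_one : h.comp 1 = X 0

namespace IsHenon

variable {h : PlaneAut k} {q : Polynomial k} {δ : k}

theorem mul_comp_zero (H : IsHenon h q δ) (f : PlaneAut k) :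
    (h * f).comp 0 = Polynomial.aeval (f.comp 0) q - C δ * f.comp 1 := by
  rw [comp_mul, H.comp_zero, map_sub, map_mul, pullback_C, pullback_polynomial]
  rfl

theorem mul_comp_one (H : IsHenon h q δ) (f : PlaneAut k) : (h * f).comp 1 = f.comp 0 := by
  rw [comp_mul, H.comp_one]
  rfl

theorem totalDegree_mul_comp_zero (H : IsHenon h q δ) {f : PlaneAut k}
    (hf : (f.comp 1).totalDegree ≤ (f.comp 0).totalDegree) :
    ((h * f).comp 0).totalDegree = q.natDegree * (f.comp 0).totalDegree := by
  have hpos := f.one_le_totalDegree_comp 0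
  have := H.two_le
  rw [H.mul_comp_zero, sub_eq_add_neg, totalDegree_add_eq_left_of_totalDegree_lt,
    totalDegree_aeval_polynomial hpos]
  rw [totalDegree_neg, totalDegree_aeval_polynomial hpos]
  refine (totalDegree_C_mul_le _ _).trans_lt ?_
  nlinarith

theorem totalDegree_pow_mul (H : IsHenon h q δ) {f : PlaneAut k}
    (hf : (f.comp 1).totalDegree ≤ (f.comp 0).totalDegree) (n : ℕ) :
    ((h ^ n * f).comp 0).totalDegree = q.natDegree ^ n * (f.comp 0).totalDegree ∧
      ((h ^ n * f).comp 1).totalDegree ≤ ((h ^ n * f).comp 0).totalDegree := by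
  induction n with
  | zero => simpa using hf
  | succ n ih =>
    rw [pow_succ', mul_assoc, H.totalDegree_mul_comp_zero ih.2, H.mul_comp_one, ih.1]
    refine ⟨by ring, Nat.le_mul_of_pos_left _ ?_⟩
    have := H.two_le
    omega

theorem totalDegree_sq_mul_comp_one (H : IsHenon h q δ) {f : PlaneAut k}
    (hf : (f.comp 1).totalDegree ≤ (f.comp 0).totalDegree) :
    ((h ^ 2 * f).comp 1).totalDegree = q.natDegree * (f.comp 0).totalDegree := by
  rw [pow_two, mul_assoc, H.mul_comp_one, H.totalDegree_mul_comp_zero hf]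

/-- Let `W = h²ψ`, so that `W³ = h⁶` has first component of degree `r⁶`. If no top degree cancels in
the products, this degree is also `(r²d)³`, whence `d = 1`. -/
theorem totalDegree_comp_zero_eq_one (H : IsHenon h q δ) {ψ : PlaneAut k} (h3 : ψ ^ 3 = 1)
    (hc : Commute ψ (h ^ 2)) (hψ : (ψ.comp 1).totalDegree ≤ (ψ.comp 0).totalDegree) :
    (ψ.comp 0).totalDegree = 1 := by
  set r := q.natDegree with hr
  set d := (ψ.comp 0).totalDegree with hd
  have hr2 : 2 ≤ r := H.two_le
  have hd1 : 1 ≤ d := ψ.one_le_totalDegree_comp 0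
  set W := h ^ 2 * ψ with hW
  have hone : ((1 : PlaneAut k).comp 1).totalDegree ≤ ((1 : PlaneAut k).comp 0).totalDegree := by
    simp [PlaneAut.comp_one]
  have W0 : (W.comp 0).totalDegree = r ^ 2 * d := (H.totalDegree_pow_mul hψ 2).1
  have W1 : (W.comp 1).totalDegree = r * d := H.totalDegree_sq_mul_comp_one hψ
  have s0 : ((h ^ 2).comp 0).totalDegree = r ^ 2 := by
    have := (H.totalDegree_pow_mul hone 2).1
    rw [mul_one, PlaneAut.comp_one, totalDegree_X, mul_one] at this
    exact this
  have s1 : ((h ^ 2).comp 1).totalDegree = r := by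
    have := H.totalDegree_sq_mul_comp_one hone
    rw [mul_one, PlaneAut.comp_one, totalDegree_X, mul_one] at this
    exact this
  have hlt : r * d < r ^ 2 * d := by nlinarith
  have hWpos : 1 ≤ (W.comp 0).totalDegree := W.one_le_totalDegree_comp 0
  -- Absence of cancellation: `W h² = h⁴ψ` has first component of degree `r⁴d = (r²d) r²`, and such
  -- a degree is reached only through the pure power of `x` in `W₁`.
  have hcoeff : coeff (Finsupp.single 0 (W.comp 0).totalDegree) (W.comp 0) ≠ 0 := by
    refine coeff_ne_zero_of_totalDegree_aeval (p := (h ^ 2).comp) ?_ hWpos ?_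
    · rw [s0, s1]; nlinarith
    · rw [← pullback_eq_aeval, ← comp_mul, W0, s0, hW, mul_assoc, hc.eq, ← mul_assoc, ← pow_add,
        (H.totalDegree_pow_mul hψ _).1]
      ring
  have hWW0 : ((W * W).comp 0).totalDegree = (r ^ 2 * d) * (r ^ 2 * d) := by
    rw [comp_mul, pullback_eq_aeval, totalDegree_aeval_eq (by rw [W0, W1]; exact hlt) hWpos hcoeff,
      W0]
  have hWW1 : ((W * W).comp 1).totalDegree < ((W * W).comp 0).totalDegree := by
    rw [hWW0, comp_mul]
    refine (totalDegree_pullback_le _ _).trans_lt ?_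
    rw [degree, W0, W1, max_eq_left hlt.le]
    exact Nat.mul_lt_mul_of_pos_right hlt (by omega)
  have hWWW : ((W * (W * W)).comp 0).totalDegree = (r ^ 2 * d) * ((r ^ 2 * d) * (r ^ 2 * d)) := by
    rw [comp_mul, pullback_eq_aeval, totalDegree_aeval_eq hWW1 hWpos hcoeff, W0, hWW0]
  have hW3 : W * (W * W) = h ^ 6 := by
    have : W ^ 3 = h ^ 6 := by rw [hW, hc.symm.mul_pow, h3, mul_one, ← pow_mul]
    rw [← this, pow_succ', pow_two]
  have h6 : ((h ^ 6).comp 0).totalDegree = r ^ 6 := by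
    have := (H.totalDegree_pow_mul hone 6).1
    rw [mul_one, PlaneAut.comp_one, totalDegree_X, mul_one] at this
    exact this
  rw [hW3, h6] at hWWW
  have hd3 : d ^ 3 = 1 := by
    have hpos : 0 < r ^ 6 := by positivity
    apply Nat.eq_of_mul_eq_mul_left hpos
    rw [mul_one]
    nth_rewrite 2 [hWWW]
    ring
  exact (Nat.pow_eq_one.1 hd3).resolve_right (by norm_num)

end IsHenon

/-- The affine automorphism `(ax + by + e, cx + dy + e')`. -/
theorem exists_comp_eq {a b c d : k} (h : a * d - b * c ≠ 0) (e e' : k) :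
    ∃ f : PlaneAut k, f.comp 0 = C a * X 0 + C b * X 1 + C e ∧
      f.comp 1 = C c * X 0 + C d * X 1 + C e' := by
  obtain ⟨r, hr⟩ : ∃ r, r * (a * d - b * c) = 1 := ⟨_, inv_mul_cancel₀ h⟩
  have hr' : C r * (C a * C d - C b * C c) = (1 : MvPolynomial (Fin 2) k) := by
    simp only [← C_mul, ← C_sub, hr, C_1]
  refine ⟨ofComp ![C a * X 0 + C b * X 1 + C e, C c * X 0 + C d * X 1 + C e']
    ![C (r * d) * X 0 + C (-(r * b)) * X 1 + C (r * (b * e' - d * e)),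
      C (-(r * c)) * X 0 + C (r * a) * X 1 + C (r * (c * e - a * e'))] ?_ ?_, ?_, ?_⟩
  · intro i
    fin_cases i
    · simp [algebraMap_eq]
      linear_combination (X 0) * hr'
    · simp [algebraMap_eq]
      linear_combination (X 1) * hr'
  · intro i
    fin_cases i
    · simp [algebraMap_eq]
      linear_combination (X 0 - C e) * hr'
    · simp [algebraMap_eq]
      linear_combination (X 1 - C e') * hr'
  · rw [comp_ofComp]; rfl
  · rw [comp_ofComp]; rfl

/-- The involution `(y, x)`. -/
noncomputable def swap (k : Type*) [Field k] : PlaneAut k :=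
  ofComp ![X 1, X 0] ![X 1, X 0] (by intro i; fin_cases i <;> simp)
    (by intro i; fin_cases i <;> simp)

theorem swap_comp_zero : (swap k).comp 0 = X 1 := by rw [swap, comp_ofComp]; rfl

theorem swap_comp_one : (swap k).comp 1 = X 0 := by rw [swap, comp_ofComp]; rfl

theorem swap_mul_swap : swap k * swap k = 1 := by
  apply ext_comp
  · rw [comp_mul, swap_comp_zero]; exact swap_comp_one
  · rw [comp_mul, swap_comp_one]; exact swap_comp_zero

theorem swap_inv : (swap k)⁻¹ = swap k := inv_eq_of_mul_eq_one_left swap_mul_swap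

theorem swap_mem_affine : swap k ∈ affine k :=
  ⟨0, 1, 1, 0, 0, 0, by simp, by simp [swap_comp_zero], by simp [swap_comp_one]⟩

theorem totalDegree_pullback_affine {a : PlaneAut k} (ha : a ∈ affine k)
    (P : MvPolynomial (Fin 2) k) : (a.pullback P).totalDegree = P.totalDegree := by
  have key : ∀ {a : PlaneAut k}, a ∈ affine k → ∀ P, (a.pullback P).totalDegree ≤ P.totalDegree :=
    fun {a} ha P => (totalDegree_pullback_le a P).trans
      (Nat.mul_le_of_le_div _ _ _ (by
        rw [Nat.le_antisymm (mem_affine_iff_degree_le.1 ha) a.one_le_degree, Nat.div_one]))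
  refine le_antisymm (key ha P) ?_
  have := key ((affine k).inv_mem ha) (a.pullback P)
  rwa [pullback_inv_pullback] at this

/-- This time-reversal symmetry reduces the case where the second component of `ψ` has the larger
degree to the other one. -/
theorem IsHenon.swap_conj_inv {h : PlaneAut k} {q : Polynomial k} {δ : k} (H : IsHenon h q δ) :
    IsHenon (swap k * h⁻¹ * swap k) (Polynomial.C δ⁻¹ * q) δ⁻¹ := by
  have hδ : C δ⁻¹ * C δ = (1 : MvPolynomial (Fin 2) k) := by
    rw [← C_mul, inv_mul_cancel₀ H.ne_zero, C_1]
  have e0 : h⁻¹.comp 0 = X 1 := by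
    have := H.mul_comp_one h⁻¹
    rw [mul_inv_cancel, PlaneAut.comp_one] at this
    exact this.symm
  have e1 : h⁻¹.comp 1 = C δ⁻¹ * (Polynomial.aeval (X 1) q - X 0) := by
    have := H.mul_comp_zero h⁻¹
    rw [mul_inv_cancel, PlaneAut.comp_one, e0] at this
    linear_combination (-h⁻¹.comp 1) * hδ + C δ⁻¹ * this
  refine ⟨?_, inv_ne_zero H.ne_zero, ?_, ?_⟩
  · rw [Polynomial.natDegree_C_mul (inv_ne_zero H.ne_zero)]
    exact H.two_le
  · rw [mul_assoc, comp_mul, swap_comp_zero]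
    change (h⁻¹ * swap k).comp 1 = _
    rw [comp_mul, e1, map_mul, map_sub, pullback_C, pullback_polynomial]
    change C δ⁻¹ * (Polynomial.aeval ((swap k).comp 1) q - (swap k).comp 0) = _
    rw [swap_comp_one, swap_comp_zero, map_mul, Polynomial.aeval_C, algebraMap_eq]
    ring
  · rw [mul_assoc, comp_mul, swap_comp_one]
    change (h⁻¹ * swap k).comp 0 = _
    rw [comp_mul, e0]
    exact swap_comp_one

/-- An automorphism of order dividing `3` commuting with the square of a Hénon automorphism is
affine. -/
theorem IsHenon.mem_affine_of_commute {h : PlaneAut k} {q : Polynomial k} {δ : k}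
    (H : IsHenon h q δ) {ψ : PlaneAut k} (h3 : ψ ^ 3 = 1) (hc : Commute ψ (h ^ 2)) :
    ψ ∈ affine k := by
  rw [mem_affine_iff_degree_le]
  rcases le_total (ψ.comp 1).totalDegree (ψ.comp 0).totalDegree with hle | hle
  · have := H.totalDegree_comp_zero_eq_one h3 hc hle
    exact max_le this.le (hle.trans this.le)
  · set ψ' := swap k * ψ * swap k with hψ'
    have hconj : ∀ x : PlaneAut k, swap k * x * swap k = MulAut.conj (swap k) x := fun x => by
      rw [MulAut.conj_apply, swap_inv]
    have d0 : (ψ'.comp 0).totalDegree = (ψ.comp 1).totalDegree := by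
      rw [hψ', comp_mul, totalDegree_pullback_affine swap_mem_affine, comp_mul, swap_comp_zero]
      rfl
    have d1 : (ψ'.comp 1).totalDegree = (ψ.comp 0).totalDegree := by
      rw [hψ', comp_mul, totalDegree_pullback_affine swap_mem_affine, comp_mul, swap_comp_one]
      rfl
    have := H.swap_conj_inv.totalDegree_comp_zero_eq_one (ψ := ψ')
      (by rw [hψ', hconj, ← map_pow, h3, map_one])
      (by
        rw [hψ', hconj, hconj, ← map_pow, inv_pow]
        exact hc.inv_right.map _)
      (by rwa [d0, d1])
    rw [d0] at this
    exact max_le (hle.trans this.le) this.le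

/-- The normal form of a product of an affine and an elementary automorphism. -/
theorem exists_isHenon_conj {a b : PlaneAut k} (ha : a ∈ affine k) (hb : b ∈ elementary k)
    (ha' : a ∉ elementary k) (hb' : b ∉ affine k) :
    ∃ τ ∈ affine k, ∃ q δ, IsHenon (τ * (b * a) * τ⁻¹) q δ := by
  obtain ⟨a₁, b₁, c, d, e, e₂, hdet, ha0, ha1⟩ := ha
  obtain ⟨α, β, γ, p, hαβ, hb0, hb1⟩ := hb
  have hc : c ≠ 0 := fun hc => ha' (mem_elementary_of_affine hdet ha0 ha1 hc)
  have hp : 2 ≤ p.natDegree := by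
    by_contra! hp
    exact hb' (mem_affine_of_elementary hαβ hb0 hb1 (by omega))
  have hα := left_ne_zero_of_mul hαβ
  have hβ := right_ne_zero_of_mul hαβ
  -- The first component of `τ` is the second component of `a`, and its second component undoes `y ↦
  -- βy + γ`. So the second component of `τba` is the first one of `τ`, as the normal form requires.
  -- The resulting `δ` is the Jacobian determinant of `ba`.
  obtain ⟨τ, hτ0, hτ1⟩ := exists_comp_eq (a := c) (b := d) (c := 0) (d := β⁻¹)
    (by simpa using ⟨hc, hβ⟩) e₂ (-(β⁻¹ * γ))
  have hτ : τ ∈ affine k := ⟨c, d, 0, β⁻¹, e₂, _, by simpa using ⟨hc, hβ⟩, hτ0, hτ1⟩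
  set q : Polynomial k := Polynomial.C c * p +
    (Polynomial.C (α * a₁ + d * β) * Polynomial.X +
      Polynomial.C (d * γ + e₂ - α * a₁ * e₂ + c * α * e + α * (b₁ * c - a₁ * d) * γ)) with hq
  refine ⟨τ, hτ, q, α * β * (a₁ * d - b₁ * c), ?_, ?_, ?_, ?_⟩
  · have hlin : (Polynomial.C (α * a₁ + d * β) * Polynomial.X +
      Polynomial.C (d * γ + e₂ - α * a₁ * e₂ + c * α * e + α * (b₁ * c - a₁ * d) * γ)
        : Polynomial k).natDegree ≤ 1 := Polynomial.natDegree_linear_le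
    rw [hq, Polynomial.natDegree_add_eq_left_of_natDegree_lt]
    · rwa [Polynomial.natDegree_C_mul hc]
    · rw [Polynomial.natDegree_C_mul hc]
      omega
  · exact mul_ne_zero hαβ hdet
  · have hββ : C β * C β⁻¹ = (1 : MvPolynomial (Fin 2) k) := by
      rw [← C_mul, mul_inv_cancel₀ hβ, C_1]
    have L : a.comp 1 = τ.comp 0 := by rw [ha1, hτ0]
    have e1 : (τ * (b * a)).comp 0 = τ.pullback
        (Polynomial.aeval (X 0) q - C (α * β * (a₁ * d - b₁ * c)) * X 1) := by
      rw [comp_mul, hτ0]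
      simp only [map_add, map_sub, map_mul, pullback_C, pullback_polynomial, pullback_mul]
      change C c * a.pullback (b.comp 0) + C d * a.pullback (b.comp 1) + C e₂ =
        Polynomial.aeval (τ.comp 0) q - _ * τ.comp 1
      rw [hb0, hb1]
      simp only [map_add, map_mul, pullback_C, pullback_polynomial]
      change C c * (C α * a.comp 0 + Polynomial.aeval (a.comp 1) p) +
        C d * (C β * a.comp 1 + C γ) + C e₂ = _
      rw [L, hq]
      simp only [map_add, map_mul, Polynomial.aeval_C, Polynomial.aeval_X, algebraMap_eq]
      rw [ha0, hτ1, hτ0]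
      simp only [C_add, C_sub, C_mul, C_neg, C_0]
      linear_combination (C α * (C a₁ * C d - C b₁ * C c) * (X 1 - C γ)) * hββ
    rw [comp_mul, e1, pullback_inv_pullback]
  · have e1 : (τ * (b * a)).comp 1 = τ.comp 0 := by
      have hββ : C β⁻¹ * C β = (1 : MvPolynomial (Fin 2) k) := by
        rw [← C_mul, inv_mul_cancel₀ hβ, C_1]
      rw [comp_mul, hτ1]
      simp only [map_add, map_mul, pullback_C, pullback_mul]
      change C 0 * a.pullback (b.comp 0) + C β⁻¹ * a.pullback (b.comp 1) + _ = _
      rw [hb1]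
      simp only [map_add, map_mul, pullback_C]
      change C 0 * _ + C β⁻¹ * (C β * a.comp 1 + C γ) + _ = _
      rw [ha1, hτ0]
      simp only [C_mul, C_neg, C_0]
      linear_combination (C c * X 0 + C d * X 1 + C e₂) * hββ
    rw [comp_mul, e1]
    exact pullback_inv_pullback τ (X 0)

end PlaneAut

/-! ### Axes of conjugate isometries. -/

theorem translationLength_conj {G X : Type*} [Group G] [PseudoEMetricSpace X] [MulAction G X]
    [IsIsometricSMul G X] (f g : G) :
    translationLength X (f * g * f⁻¹) = translationLength X g := by
  refine (MulAction.toPerm f⁻¹).iInf_congr fun x => ?_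
  rw [MulAction.toPerm_apply, ← edist_smul_left f, smul_inv_smul, smul_smul, smul_smul, mul_assoc]

theorem mem_axis_conj {G X : Type*} [Group G] [PseudoEMetricSpace X] [MulAction G X]
    [IsIsometricSMul G X] (f g : G) (x : X) :
    x ∈ axis X (f * g * f⁻¹) ↔ f⁻¹ • x ∈ axis X g := by
  change edist _ _ = _ ↔ edist _ _ = _
  rw [translationLength_conj, ← edist_smul_left f (f⁻¹ • x), smul_inv_smul, smul_smul, smul_smul,
    mul_assoc]

theorem axis_conj_eq_of_forall_smul_eq {G X : Type*} [Group G] [PseudoEMetricSpace X]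
    [MulAction G X] [IsIsometricSMul G X] {f g : G} (h : ∀ x ∈ axis X g, f • x = x) :
    axis X (f * g * f⁻¹) = axis X g := by
  ext x
  rw [mem_axis_conj]
  constructor
  · intro hx
    have h1 := h _ hx
    rw [smul_inv_smul] at h1
    rwa [← h1] at hx
  · intro hx
    rwa [inv_smul_eq_iff.2 (h x hx).symm]

namespace PlaneAut

variable {k : Type*} [Field k]

/-! ### The automorphism `(x² - y, x)` -/

theorem isHenon_henon : IsHenon (henon k) (Polynomial.X ^ 2) 1 where
  two_le := by simp
  ne_zero := one_ne_zero
  comp_zero := by rw [henon, comp_ofComp]; simp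
  comp_one := by rw [henon, comp_ofComp]; rfl

theorem henon_comp_zero : (henon k).comp 0 = X 0 ^ 2 - X 1 := by
  rw [henon, comp_ofComp]; rfl

theorem henon_inv_comp_zero : (henon k)⁻¹.comp 0 = X 1 := by
  have := isHenon_henon.mul_comp_one (henon k)⁻¹
  rw [mul_inv_cancel, comp_one] at this
  exact this.symm

theorem henon_inv_comp_one : (henon k)⁻¹.comp 1 = X 1 ^ 2 - X 0 := by
  have := isHenon_henon.mul_comp_zero (henon k)⁻¹
  rw [mul_inv_cancel, comp_one, henon_inv_comp_zero] at this
  simp only [map_pow, Polynomial.aeval_X, C_1, one_mul] at this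
  rw [this]
  ring

/-- Inverses appear because the height of a coset of `f` is read off from `f⁻¹`. -/
theorem totalDegree_henon_pow_inv (n : ℕ) : (((henon k ^ n)⁻¹).comp 1).totalDegree = 2 ^ n ∧
    (((henon k ^ n)⁻¹).comp 0).totalDegree ≤ 2 ^ n := by
  induction n with
  | zero => simp [comp_one]
  | succ n ih =>
    have h0 : ((henon k ^ (n + 1))⁻¹).comp 0 = ((henon k ^ n)⁻¹).comp 1 := by
      rw [pow_succ, mul_inv_rev, comp_mul, henon_inv_comp_zero]
      rfl
    have h1 : ((henon k ^ (n + 1))⁻¹).comp 1 =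
        ((henon k ^ n)⁻¹).comp 1 ^ 2 - ((henon k ^ n)⁻¹).comp 0 := by
      rw [pow_succ, mul_inv_rev, comp_mul, henon_inv_comp_one, map_sub, map_pow]
      rfl
    have hpos : 0 < 2 ^ n := by positivity
    rw [h0, h1, ih.1, sub_eq_add_neg, totalDegree_add_eq_left_of_totalDegree_lt,
      totalDegree_pow_of_isDomain, ih.1, pow_succ]
    · omega
    · rw [totalDegree_neg, totalDegree_pow_of_isDomain, ih.1]
      omega

theorem degree_henon_pow_inv (n : ℕ) : ((henon k ^ n)⁻¹).degree = 2 ^ n := by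
  obtain ⟨h1, h0⟩ := totalDegree_henon_pow_inv (k := k) n
  rw [degree, h1]
  exact max_eq_right h0

theorem exists_degree_pow_le_of_affine {a : PlaneAut k} (ha : a ∈ affine k) :
    ∃ N, ∀ n : ℕ, (a ^ n).degree ≤ N :=
  ⟨1, fun n => mem_affine_iff_degree_le.1 ((affine k).pow_mem ha n)⟩

theorem exists_degree_pow_le_of_elementary {b : PlaneAut k} (hb : b ∈ elementary k) :
    ∃ N, ∀ n : ℕ, (b ^ n).degree ≤ N := by
  have h1 : ∀ n : ℕ, ((b ^ n).comp 1).totalDegree = 1 := by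
    intro n
    induction n with
    | zero => simp [comp_one]
    | succ n ih => rw [pow_succ', totalDegree_elementary_mul hb, ih]
  obtain ⟨a, b', c, P, hab, hb0, hb1⟩ := hb
  refine ⟨max 1 P.natDegree, fun n => max_le ?_ ((h1 n).le.trans (le_max_left _ _))⟩
  induction n with
  | zero => simp [comp_one]
  | succ n ih =>
    rw [pow_succ', comp_mul, hb0, map_add, map_mul, pullback_C, pullback_polynomial]
    refine (totalDegree_add _ _).trans (max_le ((totalDegree_C_mul_le _ _).trans ih) ?_)
    change (Polynomial.aeval ((b ^ n).comp 1) P).totalDegree ≤ _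
    rw [totalDegree_aeval_polynomial (h1 n).ge, h1, mul_one]
    exact le_max_right _ _

/-- Degree is submultiplicative, so conjugation changes it by a bounded factor, while `g⁻ⁿ` has
degree `2 ^ n`. -/
theorem not_exists_conj_henon_pow_le {h : PlaneAut k} {N : ℕ}
    (hN : ∀ n : ℕ, ((h⁻¹ * (henon k)⁻¹ * h) ^ n).degree ≤ N) : False := by
  have key : ∀ n : ℕ, 2 ^ n ≤ h.degree * N * h⁻¹.degree := fun n => by
    have h1 : (henon k ^ n)⁻¹ = h * (h⁻¹ * (henon k)⁻¹ * h) ^ n * h⁻¹ := by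
      have : (h⁻¹ * (henon k)⁻¹ * h) ^ n = h⁻¹ * ((henon k)⁻¹) ^ n * h := by
        simpa using conj_pow (a := h⁻¹) (b := (henon k)⁻¹) (i := n)
      rw [this, inv_pow]
      group
    rw [← degree_henon_pow_inv (k := k), h1]
    exact (degree_mul_le _ _).trans (Nat.mul_le_mul_right _ ((degree_mul_le _ _).trans
      (Nat.mul_le_mul_left _ (hN n))))
  exact absurd (key _) (not_le.2 Nat.lt_two_pow_self)

theorem smul_inl_mk {G : Type*} [Group G] (A B : Subgroup G) (g h : G) :
    g • (Sum.inl (h : G ⧸ A) : (G ⧸ A) ⊕ (G ⧸ B)) = Sum.inl ((g * h : G) : G ⧸ A) := rfl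

theorem smul_inr_mk {G : Type*} [Group G] (A B : Subgroup G) (g h : G) :
    g • (Sum.inr (h : G ⧸ B) : (G ⧸ A) ⊕ (G ⧸ B)) = Sum.inr ((g * h : G) : G ⧸ B) := rfl

theorem henon_smul_ne (v : (PlaneAut k ⧸ affine k) ⊕ (PlaneAut k ⧸ elementary k)) :
    henon k • v ≠ v := by
  rcases v with q | q
  · induction q using QuotientGroup.induction_on with | H h => ?_
    intro hv
    rw [smul_inl_mk] at hv
    have h1 := QuotientGroup.eq.1 (Sum.inl_injective hv)
    rw [mul_inv_rev] at h1
    obtain ⟨N, hN⟩ := exists_degree_pow_le_of_affine h1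
    exact not_exists_conj_henon_pow_le hN
  · induction q using QuotientGroup.induction_on with | H h => ?_
    intro hv
    rw [smul_inr_mk] at hv
    have h1 := QuotientGroup.eq.1 (Sum.inr_injective hv)
    rw [mul_inv_rev] at h1
    obtain ⟨N, hN⟩ := exists_degree_pow_le_of_elementary h1
    exact not_exists_conj_henon_pow_le hN

/-! ### The axis of `(x² - y, x)` -/

theorem henon_mul_swap_mem_elementary : henon k * swap k ∈ elementary k := by
  refine ⟨-1, 1, 0, Polynomial.X ^ 2, by simp, ?_, ?_⟩
  · rw [comp_mul, henon_comp_zero, map_sub, map_pow]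
    change (swap k).comp 0 ^ 2 - (swap k).comp 1 = _
    rw [swap_comp_zero, swap_comp_one]
    simp only [map_pow, Polynomial.aeval_X, C_neg, C_1]
    ring
  · rw [comp_mul, isHenon_henon.comp_one]
    change (swap k).comp 0 = _
    rw [swap_comp_zero]
    simp

/-- The vertices `gⁿA` and `gⁿB`, for `g = (x² - y, x)` and `n ≥ 0`. -/
noncomputable def henonRay (k : Type*) [Field k] (i : ℕ) :
    (PlaneAut k ⧸ affine k) ⊕ (PlaneAut k ⧸ elementary k) :=
  if Even i then Sum.inl ((henon k ^ (i / 2) : PlaneAut k) : PlaneAut k ⧸ affine k)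
  else Sum.inr ((henon k ^ (i / 2) : PlaneAut k) : PlaneAut k ⧸ elementary k)

theorem henonRay_two_mul (n : ℕ) :
    henonRay k (2 * n) = Sum.inl ((henon k ^ n : PlaneAut k) : PlaneAut k ⧸ affine k) := by
  rw [henonRay, if_pos (even_two_mul n), Nat.mul_div_cancel_left _ two_pos]

theorem henonRay_two_mul_add_one (n : ℕ) :
    henonRay k (2 * n + 1) = Sum.inr ((henon k ^ n : PlaneAut k) : PlaneAut k ⧸ elementary k) := by
  rw [henonRay, if_neg (by simp), show (2 * n + 1) / 2 = n by omega]

theorem adj_henonRay (i : ℕ) :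
    (bassSerreGraph (affine k) (elementary k)).Adj (henonRay k i) (henonRay k (i + 1)) := by
  rcases Nat.even_or_odd' i with ⟨n, rfl | rfl⟩
  · rw [henonRay_two_mul, henonRay_two_mul_add_one]
    exact ⟨_, Or.inl ⟨rfl, rfl⟩⟩
  · rw [henonRay_two_mul_add_one, show 2 * n + 1 + 1 = 2 * (n + 1) by ring, henonRay_two_mul]
    -- As `swap` is in `A` and `g * swap` is in `B`, this element represents both `gⁿ⁺¹A` and `gⁿB`.
    refine ⟨henon k ^ (n + 1) * swap k, Or.inr ⟨?_, ?_⟩⟩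
    · congr 1
      rw [QuotientGroup.eq, inv_mul_cancel_left]
      exact swap_mem_affine
    · congr 1
      rw [QuotientGroup.eq, pow_succ, mul_assoc, inv_mul_cancel_left]
      exact henon_mul_swap_mem_elementary

theorem henonRay_injective : Function.Injective (henonRay k) := by
  -- The heights along the ray are `2 * 2 ^ n` and `2 * 2 ^ n + 1`, alternately.
  have hmono : StrictMono fun i => height (henonRay k i) := by
    refine strictMono_nat_of_lt_succ fun i => ?_
    rcases Nat.even_or_odd' i with ⟨n, rfl | rfl⟩
    · rw [henonRay_two_mul, henonRay_two_mul_add_one, height_inl, height_inr, degree_henon_pow_inv,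
        (totalDegree_henon_pow_inv n).1]
      omega
    · rw [henonRay_two_mul_add_one, show 2 * n + 1 + 1 = 2 * (n + 1) by ring, henonRay_two_mul,
        height_inl, height_inr, degree_henon_pow_inv, (totalDegree_henon_pow_inv n).1, pow_succ]
      have : 0 < 2 ^ n := by positivity
      omega
  intro i j hij
  exact hmono.injective (congrArg height hij)

theorem two_le_edist_henon_smul (p : Tree k) : 2 ≤ edist p (henon k • p) :=
  GraphRealization.two_le_edist_smul isAcyclic_bassSerreGraph
    (typeColoring (affine k) (elementary k)) (typeColoring_smul _ _ _) henon_smul_ne p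

theorem henon_smul_henonRay (n : ℕ) : henon k • henonRay k (2 * n) = henonRay k (2 * (n + 1)) := by
  rw [henonRay_two_mul, henonRay_two_mul, pow_succ']
  rfl

theorem edist_henonRay_le (n : ℕ) :
    edist (GraphRealization.ofVertex (bassSerreGraph (affine k) (elementary k)) (henonRay k (2 * n)))
      (henon k • GraphRealization.ofVertex (bassSerreGraph (affine k) (elementary k))
        (henonRay k (2 * n))) ≤ 2 := by
  rw [GraphRealization.smul_ofVertex, henon_smul_henonRay]
  refine (edist_triangle _ (GraphRealization.ofVertex (bassSerreGraph (affine k) (elementary k))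
    (henonRay k (2 * n + 1))) _).trans ?_
  refine (add_le_add (GraphRealization.edist_ofVertex_le_one (adj_henonRay (2 * n)))
    (GraphRealization.edist_ofVertex_le_one (adj_henonRay (2 * n + 1)))).trans ?_
  norm_num

theorem translationLength_henon : translationLength (Tree k) (henon k) = 2 :=
  le_antisymm ((iInf_le (fun p : Tree k => edist p (henon k • p)) _).trans (edist_henonRay_le (k := k) 0))
    (le_iInf two_le_edist_henon_smul)

theorem mem_axis_henon {p : Tree k} : p ∈ axis (Tree k) (henon k) ↔ edist p (henon k • p) ≤ 2 := by
  change _ = _ ↔ _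
  rw [translationLength_henon]
  exact ⟨le_of_eq, fun h => le_antisymm h (two_le_edist_henon_smul p)⟩

theorem isLoxodromic_henon : IsLoxodromic (Tree k) (henon k) := by
  refine ⟨?_, _, mem_axis_henon.2 (edist_henonRay_le 0)⟩
  rw [translationLength_henon]
  norm_num

theorem ediam_axis_henon : Metric.ediam (axis (Tree k) (henon k)) = ⊤ := by
  refine ENNReal.eq_top_of_forall_nnreal_le fun r => ?_
  obtain ⟨n, hn⟩ := exists_nat_ge r
  refine le_trans ?_ (Metric.edist_le_ediam_of_mem (mem_axis_henon.2 (edist_henonRay_le 0))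
    (mem_axis_henon.2 (edist_henonRay_le n)))
  refine le_trans ?_ (GraphRealization.dist_le_edist_ofVertex _ _)
  have := isAcyclic_bassSerreGraph.dist_ray (adj_henonRay (k := k)) henonRay_injective 0 (2 * n)
  rw [zero_add] at this
  rw [mul_zero, this]
  calc (r : ENNReal) ≤ (n : NNReal) := by exact_mod_cast hn
    _ = ((n : ℕ) : ENNReal) := by simp
    _ ≤ ((2 * n : ℕ) : ENNReal) := by exact_mod_cast (by omega)

/-! ### The WPD property -/

theorem quadratic_coeff_eq {p q r s p' q' r' s' : k}
    (h : (C p * X 0 ^ 2 + C q * X 0 + C r * X 1 + C s : MvPolynomial (Fin 2) k) =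
      C p' * X 0 ^ 2 + C q' * X 0 + C r' * X 1 + C s') : p = p' ∧ q = q' ∧ r = r' ∧ s = s' := by
  have key : ∀ m : Fin 2 →₀ ℕ, _ := fun m => congrArg (coeff m) h
  have h1 := key (Finsupp.single 0 2)
  have h2 := key (Finsupp.single 0 1)
  have h3 := key (Finsupp.single 1 1)
  have h4 := key 0
  simp [coeff_C_mul, coeff_X, coeff_C, coeff_X_pow, Finsupp.ext_iff] at h1 h2 h3 h4
  exact ⟨h1, h2, h3, h4⟩

/-- Coefficients are compared in `w g = g w'`, where `w' = g⁻¹wg`. -/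
theorem henon_conj_step {w : PlaneAut k} {a b e d c a' b' e' d' c' : k}
    (h0 : w.comp 0 = C a * X 0 + C b * X 1 + C e) (h1 : w.comp 1 = C d * X 1 + C c)
    (h0' : ((henon k)⁻¹ * w * henon k).comp 0 = C a' * X 0 + C b' * X 1 + C e')
    (h1' : ((henon k)⁻¹ * w * henon k).comp 1 = C d' * X 1 + C c') :
    a = d ^ 2 ∧ b = 2 * d * c ∧ e = c ^ 2 - c' ∧ a' = d ∧ b' = 0 ∧ e' = c ∧ d' = a := by
  have hw : w * henon k = henon k * ((henon k)⁻¹ * w * henon k) := by group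
  have e0 := congrArg (fun f => f.comp 0) hw
  have e1 := congrArg (fun f => f.comp 1) hw
  simp only [isHenon_henon.mul_comp_zero, isHenon_henon.mul_comp_one] at e0 e1
  rw [comp_mul, h1, h0'] at e1
  rw [comp_mul, h0, h0', h1'] at e0
  simp only [map_add, map_mul, pullback_C] at e0 e1
  change C d * (henon k).comp 1 + C c = _ at e1
  change C a * (henon k).comp 0 + C b * (henon k).comp 1 + C e = _ at e0
  rw [isHenon_henon.comp_one] at e0 e1
  rw [henon_comp_zero] at e0
  obtain ⟨-, q1, q2, q3⟩ := quadratic_coeff_eq (p := 0) (q := d) (r := 0) (s := c) (p' := 0)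
    (q' := a') (r' := b') (s' := e') (by simp only [C_0]; linear_combination e1)
  subst q1 q2 q3
  obtain ⟨r0, r1, r2, r3⟩ := quadratic_coeff_eq (p := a) (q := b) (r := -a) (s := e)
    (p' := d ^ 2) (q' := 2 * d * c) (r' := -d') (s' := c ^ 2 - c') (by
      simp only [map_pow, Polynomial.aeval_X, C_1, C_0] at e0
      simp only [C_mul, C_sub, C_pow, C_neg, show (C 2 : MvPolynomial (Fin 2) k) = 2 from rfl]
      linear_combination e0)
  exact ⟨r0, r1, r3, rfl, rfl, rfl, (neg_injective r2).symm⟩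

theorem exists_comp_eq_of_mem_inf {w : PlaneAut k} (hA : w ∈ affine k) (hB : w ∈ elementary k) :
    ∃ a b e d c : k, d ≠ 0 ∧ w.comp 0 = C a * X 0 + C b * X 1 + C e ∧
      w.comp 1 = C d * X 1 + C c := by
  obtain ⟨a, b, -, -, e, -, -, h0, -⟩ := hA
  obtain ⟨a', d, c, -, hd, -, h1⟩ := hB
  exact ⟨a, b, e, d, c, right_ne_zero_of_mul hd, h0, h1⟩

/-- The condition says that `w` fixes `gᵗA` and `gᵗB` for `t ≤ 3`. Each step of conjugation gives `b
= 2dc` and `b' = 0`, so `c₁ = c₂ = 0` when `2 ≠ 0`; then `c₀ = c₁² - c₂ = 0`. What remains is `w =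
(ax, a²y)` with `a⁴ = a`. -/
theorem finite_stabilizer (h2 : (2 : k) ≠ 0) :
    {w : PlaneAut k | ∀ t ≤ 3, (henon k ^ t)⁻¹ * w * henon k ^ t ∈ affine k ∧
      (henon k ^ t)⁻¹ * w * henon k ^ t ∈ elementary k}.Finite := by
  have hfin : {a : k | a ^ 4 = a}.Finite := by
    have hne : (Polynomial.X ^ 4 - Polynomial.X : Polynomial k) ≠ 0 :=
      fun h => by
        have := congrArg (fun P => P.coeff 4) h
        simp [Polynomial.coeff_X] at this
    refine (Polynomial.rootSet_finite (Polynomial.X ^ 4 - Polynomial.X : Polynomial k) k).subset ?_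
    intro a ha
    rw [Polynomial.mem_rootSet_of_ne hne]
    simpa [sub_eq_zero] using ha
  have hinj : Function.Injective (fun w : PlaneAut k => (w.comp 0, w.comp 1)) := fun w w' h =>
    ext_comp (Prod.ext_iff.1 h).1 (Prod.ext_iff.1 h).2
  refine Set.Finite.of_finite_image (f := fun w : PlaneAut k => (w.comp 0, w.comp 1)) ?_
    hinj.injOn
  refine (hfin.image fun a : k => ((C a * X 0 : MvPolynomial (Fin 2) k),
    (C (a ^ 2) * X 1 : MvPolynomial (Fin 2) k))).subset ?_
  rintro _ ⟨w, hw, rfl⟩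
  have step : ∀ t : ℕ, (henon k ^ (t + 1))⁻¹ * w * henon k ^ (t + 1) =
      (henon k)⁻¹ * ((henon k ^ t)⁻¹ * w * henon k ^ t) * henon k := fun t => by
    rw [pow_succ]; group
  obtain ⟨a₀, b₀, e₀, d₀, c₀, -, z₀, o₀⟩ := exists_comp_eq_of_mem_inf (hw 0 (by norm_num)).1
    (hw 0 (by norm_num)).2
  obtain ⟨a₁, b₁, e₁, d₁, c₁, n₁, z₁, o₁⟩ := exists_comp_eq_of_mem_inf (hw 1 (by norm_num)).1
    (hw 1 (by norm_num)).2
  obtain ⟨a₂, b₂, e₂, d₂, c₂, n₂, z₂, o₂⟩ := exists_comp_eq_of_mem_inf (hw 2 (by norm_num)).1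
    (hw 2 (by norm_num)).2
  obtain ⟨a₃, b₃, e₃, d₃, c₃, -, z₃, o₃⟩ := exists_comp_eq_of_mem_inf (hw 3 (by norm_num)).1
    (hw 3 (by norm_num)).2
  obtain ⟨p₁, p₂, p₃, p₄, p₅, p₆, p₇⟩ := henon_conj_step z₀ o₀ (by rw [← step]; exact z₁)
    (by rw [← step]; exact o₁)
  obtain ⟨q₁, q₂, q₃, q₄, q₅, q₆, q₇⟩ := henon_conj_step z₁ o₁ (by rw [← step]; exact z₂)
    (by rw [← step]; exact o₂)
  obtain ⟨-, r₂, -⟩ := henon_conj_step z₂ o₂ (by rw [← step]; exact z₃)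
    (by rw [← step]; exact o₃)
  have hc₁ : c₁ = 0 := by
    rw [p₅] at q₂
    simpa [h2, n₁] using q₂.symm
  have hc₂ : c₂ = 0 := by
    rw [q₅] at r₂
    simpa [h2, n₂] using r₂.symm
  have hc₀ : c₀ = 0 := by rw [← p₆, q₃, hc₁, hc₂]; ring
  have he₀ : e₀ = 0 := by rw [p₃, hc₀, hc₁]; ring
  have hb₀ : b₀ = 0 := by rw [p₂, hc₀]; ring
  have hd₀ : d₀ = a₀ ^ 2 := by rw [← p₄, q₁, p₇]
  refine ⟨a₀, ?_, ?_⟩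
  · change a₀ ^ 4 = a₀
    rw [hd₀] at p₁
    rw [← pow_mul] at p₁
    exact p₁.symm
  · simp only [pow_zero, inv_one, one_mul, mul_one] at z₀ o₀
    change _ = (w.comp 0, w.comp 1)
    rw [z₀, o₀, hb₀, he₀, hc₀, hd₀]
    simp

theorem isWPD_henon (h2 : (2 : k) ≠ 0) : IsWPD (Tree k) (henon k) := by
  refine ⟨GraphRealization.ofVertex _ (henonRay k 0), fun ε => ?_⟩
  obtain ⟨E, hE⟩ := exists_nat_ge ε
  have hE' : (ε : ENNReal) ≤ E := by
    calc (ε : ENNReal) ≤ ((E : NNReal) : ENNReal) := by exact_mod_cast hE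
      _ = E := by simp
  -- The ray point `g^N v₀` has index `M = 4E + 20`, which leaves room for a segment of length `7`
  -- at distance more than `E` from both ends.
  refine ⟨2 * E + 10, ?_⟩
  set M := 2 * (2 * E + 10) with hM
  have hx : henon k ^ (2 * E + 10) • GraphRealization.ofVertex
      (bassSerreGraph (affine k) (elementary k)) (henonRay k 0) =
      GraphRealization.ofVertex _ (henonRay k M) := by
    rw [GraphRealization.smul_ofVertex, hM, henonRay_two_mul, ← mul_zero 2, henonRay_two_mul,
      pow_zero]
    change GraphRealization.ofVertex _ (Sum.inl ((henon k ^ (2 * E + 10) * 1 : PlaneAut k) :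
      PlaneAut k ⧸ affine k)) = _
    rw [mul_one]
  rw [hx]
  -- If `h` sends the segment of the ray starting at `gᵐA` to the one starting at `g^(E+1)A`, then
  -- `g^(-(E+1)) h gᵐ` is one of the finitely many elements of `finite_stabilizer`.
  refine ((Finset.range (M + 1)).finite_toSet.biUnion fun m _ =>
    (finite_stabilizer h2).image fun w => henon k ^ (E + 1) * w * (henon k ^ m)⁻¹).subset ?_
  rintro h ⟨h0, hMd⟩
  rw [GraphRealization.smul_ofVertex] at h0 hMd
  obtain ⟨c, hc⟩ := GraphRealization.exists_walk_length_le (h0.trans hE')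
  obtain ⟨d, hd⟩ := GraphRealization.exists_walk_length_le (hMd.trans hE')
  have hadj' : ∀ i, (bassSerreGraph (affine k) (elementary k)).Adj (h • henonRay k i)
      (h • henonRay k (i + 1)) := fun i => ActsOnGraph.adj_smul h _ _ (adj_henonRay i)
  have hinj' : Function.Injective fun i => h • henonRay k i :=
    (MulAction.injective h).comp henonRay_injective
  obtain ⟨j, hjM, hj⟩ := isAcyclic_bassSerreGraph.exists_eq_of_ray_close adj_henonRay
    henonRay_injective hadj' hinj' c hc d hd (i := 2 * (E + 1) + 7) (by omega) (by omega)
  obtain ⟨l, hl, hseg⟩ := isAcyclic_bassSerreGraph.exists_common_segment adj_henonRay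
    henonRay_injective hadj' hinj' c hc (i := 2 * (E + 1)) (by omega) 7 j hj
  -- `h` preserves types, so the shift between the two rays is even.
  have hlm : ∃ m, l = 2 * m := by
    rcases Nat.even_or_odd' l with ⟨m, hm | hm⟩
    · exact ⟨m, hm⟩
    · have := hseg 0 (by norm_num)
      rw [add_zero, add_zero, hm, henonRay_two_mul, henonRay_two_mul_add_one] at this
      exact absurd this Sum.inl_ne_inr
  obtain ⟨m, rfl⟩ := hlm
  simp only [Set.mem_iUnion]
  refine ⟨m, by simp; omega, (henon k ^ (E + 1))⁻¹ * h * henon k ^ m, fun t ht => ⟨?_, ?_⟩, by group⟩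
  · have := hseg (2 * t) (by omega)
    rw [← mul_add, ← mul_add, henonRay_two_mul, henonRay_two_mul, smul_inl_mk] at this
    have := QuotientGroup.eq.1 (Sum.inl_injective this)
    rw [pow_add, pow_add] at this
    convert this using 1
    group
  · have := hseg (2 * t + 1) (by omega)
    rw [← add_assoc, ← add_assoc, ← mul_add, ← mul_add, henonRay_two_mul_add_one,
      henonRay_two_mul_add_one, smul_inr_mk] at this
    have := QuotientGroup.eq.1 (Sum.inr_injective this)
    rw [pow_add, pow_add] at this
    convert this using 1
    group

/-! ### Elements of order `3` commuting with the square of `(x² - y, x)` -/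

theorem exists_adj_adj_of_dist_eq_two {V : Type*} {Γ : SimpleGraph V} {u v : V}
    (h : Γ.dist u v = 2) : ∃ w, Γ.Adj u w ∧ Γ.Adj w v := by
  obtain ⟨p, hp⟩ := SimpleGraph.exists_walk_of_dist_ne_zero (by rw [h]; norm_num)
  rw [h] at hp
  match p, hp with
  | .cons h1 (.cons h2 .nil), _ => exact ⟨_, h1, h2⟩

/-- Write `q = f₁A` and let `f₂B = f₁B` be the vertex between `q` and `gq`. Then `f₁⁻¹gf₁ = ba` with
`b = f₁⁻¹f₂` in `B` and `a = f₂⁻¹gf₁` in `A`, neither in `A ∩ B` because `g` fixes no vertex. The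
affine normalization of `ba` shows that `f₁⁻¹ff₁` is affine. -/
theorem smul_inl_eq_of_commute_sq {g f : PlaneAut k}
    (hfix : ∀ v : (PlaneAut k ⧸ affine k) ⊕ (PlaneAut k ⧸ elementary k), g • v ≠ v)
    (h3 : f ^ 3 = 1) (hc : Commute f (g ^ 2)) {q : PlaneAut k ⧸ affine k}
    (hq : (bassSerreGraph (affine k) (elementary k)).dist (Sum.inl q) (g • Sum.inl q) = 2) :
    f • (Sum.inl q : (PlaneAut k ⧸ affine k) ⊕ (PlaneAut k ⧸ elementary k)) = Sum.inl q := by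
  obtain ⟨w, ⟨f₁, ⟨h1, rfl⟩ | ⟨-, h1⟩⟩, ⟨f₂, ⟨h2, -⟩ | ⟨h2, h2'⟩⟩⟩ :=
    exists_adj_adj_of_dist_eq_two hq
  · simp at h2
  · obtain rfl := Sum.inl_injective h1
    have hA := QuotientGroup.eq.1 (Sum.inl_injective h2.symm)
    have hB := QuotientGroup.eq.1 (Sum.inr_injective h2')
    change f₂⁻¹ * (g * f₁) ∈ affine k at hA
    have hA' : f₂⁻¹ * (g * f₁) ∉ elementary k := fun h => by
      apply hfix (Sum.inr (f₁ : PlaneAut k ⧸ elementary k))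
      rw [smul_inr_mk, h2', QuotientGroup.eq.2 h]
    have hB' : f₁⁻¹ * f₂ ∉ affine k := fun h => by
      apply hfix (Sum.inl (f₁ : PlaneAut k ⧸ affine k))
      rw [h2, QuotientGroup.eq.2 h]
    obtain ⟨τ, hτ, r, δ, H⟩ := exists_isHenon_conj hA hB hA' hB'
    have hconj : ∀ x : PlaneAut k, τ * (f₁⁻¹ * x * f₁) * τ⁻¹ = MulAut.conj (τ * f₁⁻¹) x := by
      intro x
      rw [MulAut.conj_apply]
      group
    rw [show f₁⁻¹ * f₂ * (f₂⁻¹ * (g * f₁)) = f₁⁻¹ * g * f₁ by group, hconj] at H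
    have hψ := H.mem_affine_of_commute (ψ := MulAut.conj (τ * f₁⁻¹) f)
      (by rw [← map_pow, h3, map_one]) (by rw [← map_pow]; exact hc.map _)
    rw [← hconj] at hψ
    have hmem : f₁⁻¹ * f * f₁ ∈ affine k := by
      have := (affine k).mul_mem ((affine k).mul_mem ((affine k).inv_mem hτ) hψ) hτ
      convert this using 1
      group
    have : ((f₁ : PlaneAut k) : PlaneAut k ⧸ affine k) = (f * f₁ : PlaneAut k) := by
      rw [QuotientGroup.eq, ← mul_assoc]
      exact hmem
    exact congrArg Sum.inl this.symm
  · simp at h1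
  · simp at h1

theorem smul_eq_of_commute_sq {g f : PlaneAut k}
    (hfix : ∀ v : (PlaneAut k ⧸ affine k) ⊕ (PlaneAut k ⧸ elementary k), g • v ≠ v)
    (h3 : f ^ 3 = 1) (hc : Commute f (g ^ 2))
    {v : (PlaneAut k ⧸ affine k) ⊕ (PlaneAut k ⧸ elementary k)}
    (hv : (bassSerreGraph (affine k) (elementary k)).dist v (g • v) = 2) : f • v = v := by
  rcases v with q | q
  · exact smul_inl_eq_of_commute_sq hfix h3 hc hv
  · set Γ := bassSerreGraph (affine k) (elementary k) with hΓ
    obtain ⟨w, h1, h2⟩ := exists_adj_adj_of_dist_eq_two hv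
    have hdist : ∀ {x y}, Γ.Adj x y → Γ.Adj y (g • x) → Γ.dist x (g • x) = 2 := by
      intro x y e1 e2
      refine le_antisymm (SimpleGraph.dist_le (.cons e1 (.cons e2 .nil))) ?_
      exact GraphRealization.two_le_dist_smul (typeColoring (affine k) (elementary k))
        (typeColoring_smul _ _ _) hfix (e1.reachable.trans e2.reachable)
    have hw := hdist h2 (ActsOnGraph.adj_smul g _ _ h1)
    have hadj' : Γ.Adj (Sum.inr q) (g⁻¹ • w) := by
      have := ActsOnGraph.adj_smul g⁻¹ _ _ h2.symm
      rwa [inv_smul_smul] at this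
    have hw' : Γ.dist (g⁻¹ • w) (g • g⁻¹ • w) = 2 :=
      hdist hadj'.symm (by rw [smul_inv_smul]; exact h1)
    -- The neighbours `w` and `g⁻¹w` of `v` are distinct and both fixed by `f`, so `f` also fixes
    -- their only common neighbour `v`.
    have hne : w ≠ g⁻¹ • w := fun h => hfix w (eq_inv_smul_iff.1 h)
    obtain ⟨q', rfl⟩ : ∃ q', w = Sum.inl q' := by
      obtain ⟨f₁, ⟨h, -⟩ | ⟨rfl, -⟩⟩ := h1
      · simp at h
      · exact ⟨_, rfl⟩
    have hfw := smul_inl_eq_of_commute_sq hfix h3 hc hw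
    have hfw' : f • g⁻¹ • (Sum.inl q' : (PlaneAut k ⧸ affine k) ⊕ (PlaneAut k ⧸ elementary k)) =
        g⁻¹ • Sum.inl q' := smul_inl_eq_of_commute_sq (q := g⁻¹ • q') hfix h3 hc hw'
    refine isAcyclic_bassSerreGraph.eq_of_adj_adj (b := Sum.inl q') (d := g⁻¹ • Sum.inl q')
      ?_ h1 ?_ hadj' hne
    · have := ActsOnGraph.adj_smul f _ _ h1
      rwa [hfw] at this
    · have := ActsOnGraph.adj_smul f _ _ hadj'
      rwa [hfw'] at this

theorem smul_eq_of_mem_axis_henon {f : PlaneAut k} (h3 : f ^ 3 = 1) (hc : Commute f (henon k ^ 2))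
    {p : Tree k} (hp : p ∈ axis (Tree k) (henon k)) : f • p = p :=
  GraphRealization.smul_eq_self_of_fix fun _ hu => smul_eq_of_commute_sq henon_smul_ne h3 hc
    (GraphRealization.dist_smul_eq_two_of_edist_le isAcyclic_bassSerreGraph
      (typeColoring (affine k) (elementary k)) (typeColoring_smul _ _ _) henon_smul_ne
      (mem_axis_henon.1 hp) hu)

theorem axis_conj_henon {f : PlaneAut k} (h3 : f ^ 3 = 1) (hc : Commute f (henon k ^ 2)) :
    axis (Tree k) (f * henon k * f⁻¹) = axis (Tree k) (henon k) :=
  axis_conj_eq_of_forall_smul_eq fun _ => smul_eq_of_mem_axis_henon h3 hc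

theorem not_isTight_henon {f : PlaneAut k} (h3 : f ^ 3 = 1) (hc : Commute f (henon k ^ 2))
    (h1 : f * henon k * f⁻¹ ≠ henon k) (h2 : f * henon k * f⁻¹ ≠ (henon k)⁻¹) :
    ¬ IsTight (Tree k) (henon k) := by
  rintro ⟨-, B, -, hB⟩
  have himage : (fun x : Tree k => f • x) '' axis (Tree k) (henon k) = axis (Tree k) (henon k) :=
    (Set.image_congr fun p hp => smul_eq_of_mem_axis_henon h3 hc hp).trans (Set.image_id' _)
  refine (hB f ?_).elim h1 h2
  rw [himage, Set.inter_self, ediam_axis_henon]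
  exact ENNReal.ofReal_lt_top

/-! ### Diagonal automorphisms -/

theorem diag_comp_zero (a b : kˣ) : (diag a b).comp 0 = C (a : k) * X 0 := by
  rw [diag, comp_ofComp]; rfl

theorem diag_comp_one (a b : kˣ) : (diag a b).comp 1 = C (b : k) * X 1 := by
  rw [diag, comp_ofComp]; rfl

theorem diag_mul_diag (a b a' b' : kˣ) : diag a b * diag a' b' = diag (a * a') (b * b') := by
  apply ext_comp
  · rw [comp_mul, diag_comp_zero, map_mul, pullback_C]
    change C (a : k) * (diag a' b').comp 0 = _
    rw [diag_comp_zero, diag_comp_zero, Units.val_mul, C_mul, mul_assoc]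
  · rw [comp_mul, diag_comp_one, map_mul, pullback_C]
    change C (b : k) * (diag a' b').comp 1 = _
    rw [diag_comp_one, diag_comp_one, Units.val_mul, C_mul, mul_assoc]

theorem diag_one : diag (1 : kˣ) 1 = 1 := by
  apply ext_comp
  · rw [diag_comp_zero, comp_one]; simp
  · rw [diag_comp_one, comp_one]; simp

theorem diag_left_injective {a b a' b' : kˣ} (h : diag a b = diag a' b') : a = a' := by
  have := congrArg (fun f => coeff (Finsupp.single 0 1) (f.comp 0)) h
  simp only [diag_comp_zero, coeff_C_mul, coeff_X] at this
  simpa [Units.ext_iff] using this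

theorem henon_mul_diag (a : kˣ) : henon k * diag a (a ^ 2) = diag (a ^ 2) a * henon k := by
  apply ext_comp
  · rw [isHenon_henon.mul_comp_zero, comp_mul, diag_comp_zero, diag_comp_zero, diag_comp_one,
      map_mul, pullback_C]
    change _ = C _ * (henon k).comp 0
    rw [henon_comp_zero]
    simp only [map_pow, Polynomial.aeval_X, C_1, Units.val_pow_eq_pow_val]
    ring
  · rw [isHenon_henon.mul_comp_one, comp_mul, diag_comp_zero, diag_comp_one, map_mul, pullback_C]
    change _ = C _ * (henon k).comp 1
    rw [isHenon_henon.comp_one]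

/-- The first components have degrees `2` and `1`. -/
theorem diag_mul_henon_ne (a b : kˣ) : diag a b * henon k ≠ (henon k)⁻¹ * diag a b := by
  intro h
  have h0 := congrArg (fun f => (f.comp 0).totalDegree) h
  rw [comp_mul, diag_comp_zero, map_mul, pullback_C, totalDegree_C_mul a.ne_zero, comp_mul,
    henon_inv_comp_zero] at h0
  change ((henon k).comp 0).totalDegree = ((diag a b).comp 1).totalDegree at h0
  rw [diag_comp_one, totalDegree_C_mul b.ne_zero, totalDegree_X, ← mul_one (henon k),
    isHenon_henon.totalDegree_mul_comp_zero (by simp [comp_one])] at h0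
  simp [comp_one] at h0

end PlaneAut

/-! ### The main theorem. -/

theorem mainTheorem8 {k : Type*} [Field k] (hk : ringChar k ≠ 2) (j : kˣ)
    (hj : IsPrimitiveRoot j 3) (g f : PlaneAut k) (hg : g = PlaneAut.henon k)
    (hf : f = PlaneAut.diag j (j ^ 2)) :
    (IsLoxodromic (PlaneAut.Tree k) g ∧ IsWPD (PlaneAut.Tree k) g ∧
      ¬ IsTight (PlaneAut.Tree k) g) ∧
    g * f = f ^ 2 * g ∧ Commute f (g ^ 2) ∧ ¬ Commute f g ∧
    axis (PlaneAut.Tree k) (f * g * f⁻¹) = axis (PlaneAut.Tree k) g ∧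
    f * g * f⁻¹ ≠ g ∧ f * g * f⁻¹ ≠ g⁻¹ := by
  subst hg hf
  have hj3 : j ^ 3 = 1 := hj.pow_eq_one
  have hf2 : PlaneAut.diag j (j ^ 2) ^ 2 = PlaneAut.diag (j ^ 2) j := by
    rw [pow_two, PlaneAut.diag_mul_diag, ← pow_two, ← pow_add, pow_succ j 3, hj3, one_mul]
  have hf3 : PlaneAut.diag j (j ^ 2) ^ 3 = 1 := by
    rw [pow_succ, hf2, PlaneAut.diag_mul_diag, ← pow_succ, ← pow_succ', hj3, PlaneAut.diag_one]
  set f := PlaneAut.diag j (j ^ 2) with hf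
  set g := PlaneAut.henon k with hg
  have hgf : g * f = f ^ 2 * g := by rw [hf2]; exact PlaneAut.henon_mul_diag j
  have hcomm : Commute f (g ^ 2) := by
    -- Conjugation by `g` squares `f`; doing it twice gives `f⁴ = f`.
    have h1 : g * f ^ 2 = f * g := by
      calc g * f ^ 2 = g * f * f := by rw [pow_two, mul_assoc]
        _ = f ^ 2 * (g * f) := by rw [hgf, mul_assoc, hgf]
        _ = f ^ 3 * (f * g) := by rw [hgf]; group
        _ = f * g := by rw [hf3, one_mul]
    change f * g ^ 2 = g ^ 2 * f
    rw [pow_two, ← mul_assoc, ← h1, mul_assoc, ← hgf, mul_assoc]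
  have hncomm : ¬ Commute f g := by
    intro h
    have h1 : f ^ 2 = f := by
      apply mul_right_cancel (b := g)
      rw [← hgf, h.eq]
    rw [hf2] at h1
    have h2 : j ^ 2 = j := PlaneAut.diag_left_injective h1
    have h3 : j = 1 := by
      rw [pow_two] at h2
      exact mul_eq_left.1 h2
    exact hj.ne_one (by norm_num) h3
  have hne : f * g * f⁻¹ ≠ g := fun h => hncomm (mul_inv_eq_iff_eq_mul.1 h)
  have hne' : f * g * f⁻¹ ≠ g⁻¹ := fun h =>
    PlaneAut.diag_mul_henon_ne j (j ^ 2) (mul_inv_eq_iff_eq_mul.1 h)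
  exact ⟨⟨PlaneAut.isLoxodromic_henon, PlaneAut.isWPD_henon (Ring.two_ne_zero hk),
    PlaneAut.not_isTight_henon hf3 hcomm hne hne'⟩, hgf, hcomm, hncomm,
    PlaneAut.axis_conj_henon hf3 hcomm, hne, hne'⟩
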